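/- A $(0,1)$-matrix $M$ of size $n\times n$ is called \emph{indecomposable} if it has no $s\times(n-s)$ zero submatrix with $0<s<n$, and \emph{quadrangular} (or \emph{combinatorially orthogonal}) if the inner product of any two distinct rows, and of any two distinct columns, is not equal to $1$; the zero-pattern of every unitary matrix is quadrangular. The \emph{zero-pattern} (support) $\underline{X}$ of a matrix $X$ is the $(0,1)$-matrix with $\underline{X}_{i,j}=1$ if and only if $X_{i,j}\neq 0$. For $n\ge 2$, call an $n\times n$ $(0,1)$-matrix a \emph{maximal zero-pattern} if it is indecomposable, quadrangular, and has exactly $(n-2)^2$ zero entries. Proposition. Let $n\ge 2$. If $M$ is a maximal $n\times n$ zero-pattern, then there exists a rational orthogonal matrix $X\in O_n(\mathbb{Q})$ (that is, an $n\times n$ matrix with rational entries and $XX^{T}=I$) such that $\underline{X}=M$. -/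

import Mathlib

/-- The zero-pattern (support) of a matrix `X`: the `(0,1)`-matrix of the same size with a `1`
exactly where `X` has a nonzero entry. -/
def zeroPattern {m n : ℕ} {K : Type*} [Zero K] [DecidableEq K]
    (X : Matrix (Fin m) (Fin n) K) : Matrix (Fin m) (Fin n) ℕ :=
  fun i j => if X i j ≠ 0 then 1 else 0

/-- A `(0,1)`-matrix. -/
def IsZeroOneMatrix {m n : ℕ} (M : Matrix (Fin m) (Fin n) ℕ) : Prop :=
  ∀ i j, M i j = 0 ∨ M i j = 1

/-- An `n × n` matrix is decomposable if it contains an `s × (n - s)` zero submatrix for some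
`0 < s < n` (rows indexed by `R`, columns indexed by `C`, not necessarily contiguous). -/
def IsDecomposable {n : ℕ} (M : Matrix (Fin n) (Fin n) ℕ) : Prop :=
  ∃ (s : ℕ) (R C : Finset (Fin n)), 0 < s ∧ s < n ∧ R.card = s ∧ C.card = n - s ∧
    ∀ i ∈ R, ∀ j ∈ C, M i j = 0

/-- An indecomposable square matrix. -/
def IsIndecomposable {n : ℕ} (M : Matrix (Fin n) (Fin n) ℕ) : Prop :=
  ¬ IsDecomposable M

/-- A `(0,1)`-matrix is quadrangular (combinatorially orthogonal) if the inner product of any two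
distinct rows, and of any two distinct columns, is not `1`. -/
def IsQuadrangular {m n : ℕ} (M : Matrix (Fin m) (Fin n) ℕ) : Prop :=
  (∀ i i' : Fin m, i ≠ i' → ∑ k, M i k * M i' k ≠ 1) ∧
    (∀ j j' : Fin n, j ≠ j' → ∑ k, M k j * M k j' ≠ 1)

/-- The number of zero entries of a matrix. -/
def numZeros {m n : ℕ} (M : Matrix (Fin m) (Fin n) ℕ) : ℕ :=
  (Finset.univ.filter fun p : Fin m × Fin n => M p.1 p.2 = 0).card

/-- A maximal zero-pattern of size `n` (used for `n ≥ 2`): an indecomposable quadrangular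
`(0,1)`-matrix with exactly `(n - 2) ^ 2` zero entries. -/
structure IsMaximalZeroPattern {n : ℕ} (M : Matrix (Fin n) (Fin n) ℕ) : Prop where
  isZeroOne : IsZeroOneMatrix M
  indecomposable : IsIndecomposable M
  quadrangular : IsQuadrangular M
  numZeros_eq : numZeros M = (n - 2) ^ 2

/-! View the rows and columns of `M` as the vertices of a bipartite graph whose edges are the
nonzero entries. Indecomposability makes it connected, and quadrangularity says that no two vertices
have exactly one common neighbour. On at least three vertices, such a graph satisfies `4 * A.card ≤
G.degSum A + 8`: a four-cycle grows to the whole graph without `degSum - 4 * card` ever dropping.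
Having exactly `(n - 2) ^ 2` zeros means equality in this bound.

If all degrees are at least three, equality forces a cubic graph on eight vertices
(`IsQuadConn.card_eq_eight`). Then `M` has order four with one zero in each row and column, and a
row permutation of `quaternionMatrix` realises it. Otherwise, up to transposition, some row has
exactly two nonzero entries, and the two columns it meets have equal support. Deleting this row and
one of these columns leaves a maximal zero-pattern (`IsMaximalZeroPattern.submatrix`). A realisation
of the smaller pattern, bordered and rotated by a 3-4-5 rotation, realises `M`.

The delicate point is that the deletion preserves quadrangularity: two other rows meeting the twin
columns need a third common column. By `IsQuadConn.twins_or_isSeparated`, such rows are either equal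
or separated by the two columns. If they are equal, lacking a third common column would create a
forbidden zero block; if they are separated, the two sides create zero blocks whose total size
contradicts indecomposability. -/

namespace SimpleGraph

/-! ### Neighbour counts and degree sums on finite vertex sets -/

variable {V : Type*} (G : SimpleGraph V)

open Classical in
/-- The neighbours of `x` inside the finset `A`. -/
noncomputable def nbrIn (A : Finset V) (x : V) : Finset V := A.filter (G.Adj x)

/-- The degree sum of the graph induced on `A`, that is, twice its number of edges. -/
noncomputable def degSum (A : Finset V) : ℕ := ∑ x ∈ A, (G.nbrIn A x).card

/-- The graph induced on `A` is connected, and no two of its vertices have exactly one common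
neighbour. -/
structure IsQuadConn (A : Finset V) : Prop where
  exists_adj : ∀ B ⊆ A, B.Nonempty → B ≠ A → ∃ x ∈ B, ∃ y ∈ A, y ∉ B ∧ G.Adj x y
  exists_other : ∀ x ∈ A, ∀ y ∈ A, ∀ s ∈ A, x ≠ y → G.Adj x s → G.Adj y s →
    ∃ s' ∈ A, s' ≠ s ∧ G.Adj x s' ∧ G.Adj y s'

variable {G} {A S : Finset V}

@[simp] theorem mem_nbrIn {x y : V} : y ∈ G.nbrIn A x ↔ y ∈ A ∧ G.Adj x y := by
  simp [nbrIn]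

theorem nbrIn_mono (h : S ⊆ A) (x : V) : G.nbrIn S x ⊆ G.nbrIn A x := fun y hy => by
  rw [mem_nbrIn] at hy ⊢
  exact ⟨h hy.1, hy.2⟩

theorem card_nbrIn_mono (h : S ⊆ A) (x : V) : (G.nbrIn S x).card ≤ (G.nbrIn A x).card :=
  Finset.card_le_card (nbrIn_mono h x)

theorem sum_card_nbrIn_comm (S H : Finset V) :
    ∑ s ∈ S, (G.nbrIn H s).card = ∑ x ∈ H, (G.nbrIn S x).card := by
  classical
  have h := Finset.sum_card_bipartiteAbove_eq_sum_card_bipartiteBelow (s := S) (t := H) G.Adj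
  rw [show (∑ s ∈ S, (G.nbrIn H s).card) = ∑ s ∈ S, (Finset.bipartiteAbove G.Adj H s).card from
    Finset.sum_congr rfl fun s _ => congrArg Finset.card <| by
      ext y; simp [Finset.bipartiteAbove], h]
  exact Finset.sum_congr rfl fun s _ => congrArg Finset.card <| by
      ext y; simp [Finset.bipartiteBelow, G.adj_comm]

/-- `S` is closed in `A`: no vertex of `A` outside `S` has two neighbours in `S`. -/
def IsClosedIn (G : SimpleGraph V) (A S : Finset V) : Prop :=
  ∀ x ∈ A, x ∉ S → ∀ s ∈ S, ∀ t ∈ S, G.Adj x s → G.Adj x t → s = t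

theorem isClosedIn_of_card (h : ∀ x ∈ A, x ∉ S → (G.nbrIn S x).card < 2) :
    G.IsClosedIn A S := fun x hx hxS s hs t ht hxs hxt =>
  Finset.card_le_one.1 (Nat.le_of_lt_succ (h x hx hxS)) s (mem_nbrIn.2 ⟨hs, hxs⟩) t
    (mem_nbrIn.2 ⟨ht, hxt⟩)

theorem two_mul_card_le_degSum (hdeg : ∀ s ∈ S, 2 ≤ (G.nbrIn S s).card) :
    2 * S.card ≤ G.degSum S := by
  rw [mul_comm]
  exact Finset.card_nsmul_le_sum _ _ _ hdeg

theorem IsQuadConn.nbrIn_nonempty (hA : G.IsQuadConn A) (h2 : 2 ≤ A.card) {x : V} (hx : x ∈ A) :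
    (G.nbrIn A x).Nonempty := by
  obtain ⟨y, hy, z, hz, -, hyz⟩ := hA.exists_adj {x} (by simpa using hx) (by simp)
    (by rintro rfl; simp at h2)
  rw [Finset.mem_singleton] at hy
  subst hy
  exact ⟨z, mem_nbrIn.2 ⟨hz, hyz⟩⟩

/-- Some predicate separates `i` from `i'` in the graph induced on `A \ {u, v}`. -/
def IsSeparated (G : SimpleGraph V) (A : Finset V) (u v i i' : V) : Prop :=
  ∃ P : V → Prop, P i ∧ ¬ P i' ∧ ∀ x ∈ A, ∀ y ∈ A, x ≠ u → x ≠ v → y ≠ u → y ≠ v →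
    G.Adj x y → (P x ↔ P y)

theorem IsSeparated.symm {u v i i' : V} (h : G.IsSeparated A u v i i') :
    G.IsSeparated A u v i' i := by
  obtain ⟨P, h1, h2, h3⟩ := h
  exact ⟨fun x => ¬ P x, h2, not_not.2 h1, fun x hx y hy a b c d e =>
    not_congr (h3 x hx y hy a b c d e)⟩

variable [DecidableEq V]

theorem card_nbrIn_union {H : Finset V} (h : Disjoint S H) (x : V) :
    (G.nbrIn (S ∪ H) x).card = (G.nbrIn S x).card + (G.nbrIn H x).card := by
  classical
  rw [← Finset.card_union_of_disjoint]
  · congr 1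
    ext y
    simp [or_and_right]
  · rw [Finset.disjoint_left] at h ⊢
    intro y hy hy'
    exact h (mem_nbrIn.1 hy).1 (mem_nbrIn.1 hy').1

theorem degSum_union {H : Finset V} (h : Disjoint S H) :
    G.degSum (S ∪ H) = G.degSum S + G.degSum H + 2 * ∑ x ∈ H, (G.nbrIn S x).card := by
  unfold degSum
  rw [Finset.sum_union h]
  simp only [card_nbrIn_union h, Finset.sum_add_distrib]
  rw [sum_card_nbrIn_comm S H]
  ring

theorem degSum_insert {x : V} (h : x ∉ S) :
    G.degSum (insert x S) = G.degSum S + 2 * (G.nbrIn S x).card := by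
  have h' : Disjoint S {x} := by simpa using h
  have h0 : G.degSum {x} = 0 := by
    simp only [degSum, Finset.sum_singleton, Finset.card_eq_zero]
    ext y
    simp only [mem_nbrIn, Finset.mem_singleton, Finset.notMem_empty, iff_false, not_and]
    rintro rfl
    exact G.irrefl
  rw [Finset.insert_eq, Finset.union_comm, degSum_union h', h0]
  simp

/-! ### Boundaries of closed sets and the growth argument -/

variable (G) in
/-- The vertices of `A` outside `S` with a neighbour in `S`. -/
noncomputable def outerBoundary (A S : Finset V) : Finset V :=
  open Classical in (A \ S).filter fun x => ∃ s ∈ S, G.Adj x s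

@[simp] theorem mem_outerBoundary {x : V} :
    x ∈ G.outerBoundary A S ↔ x ∈ A ∧ x ∉ S ∧ ∃ s ∈ S, G.Adj x s := by
  simp [outerBoundary, and_assoc]

theorem disjoint_outerBoundary : Disjoint S (G.outerBoundary A S) :=
  Finset.disjoint_left.2 fun _ hx hx' => (mem_outerBoundary.1 hx').2.1 hx

theorem IsQuadConn.outerBoundary_nonempty (hA : G.IsQuadConn A) (hSA : S ⊆ A) (hS : S.Nonempty)
    (hne : S ≠ A) : (G.outerBoundary A S).Nonempty := by
  obtain ⟨x, hx, y, hy, hyS, hxy⟩ := hA.exists_adj S hSA hS hne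
  exact ⟨y, mem_outerBoundary.2 ⟨hy, hyS, x, hx, hxy.symm⟩⟩

/-- Since `x` and `t` share the neighbour `s`, they share another one; closedness keeps it out of
`S`. Edges of `S` thus lift to the boundary. -/
theorem IsQuadConn.exists_lift (hA : G.IsQuadConn A) (hSA : S ⊆ A) (hc : G.IsClosedIn A S)
    {x s t : V} (hx : x ∈ G.outerBoundary A S) (hs : s ∈ S) (hxs : G.Adj x s) (ht : t ∈ S)
    (hst : G.Adj s t) : ∃ y ∈ G.outerBoundary A S, G.Adj x y ∧ G.Adj y t := by
  obtain ⟨hxA, hxS, -⟩ := mem_outerBoundary.1 hx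
  obtain ⟨y, hy, hys, hxy, hty⟩ := hA.exists_other x hxA t (hSA ht) s (hSA hs)
    (by rintro rfl; exact hxS ht) hxs hst.symm
  refine ⟨y, mem_outerBoundary.2 ⟨hy, fun hyS => hys ?_, t, ht, hty.symm⟩, hxy, hty.symm⟩
  exact hc x hxA hxS y hyS s hs hxy hxs

/-- Lifts of distinct edges at `s` are distinct, because a boundary vertex has only one neighbour in
`S`. -/
theorem IsQuadConn.card_nbrIn_le_lift (hA : G.IsQuadConn A) (hSA : S ⊆ A)
    (hc : G.IsClosedIn A S) {x s : V} (hx : x ∈ G.outerBoundary A S) (hs : s ∈ S)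
    (hxs : G.Adj x s) :
    (G.nbrIn S s).card ≤ (G.nbrIn (G.outerBoundary A S) x).card := by
  refine Finset.card_le_card_of_forall_subsingleton (fun t y => G.Adj y t) ?_ ?_
  · intro t ht
    obtain ⟨ht, hst⟩ := mem_nbrIn.1 ht
    obtain ⟨y, hy, hxy, hyt⟩ := hA.exists_lift hSA hc hx hs hxs ht hst
    exact ⟨y, mem_nbrIn.2 ⟨hy, hxy⟩, hyt⟩
  · intro y hy t ht t' ht'
    obtain ⟨hyA, hyS, -⟩ := mem_outerBoundary.1 (mem_nbrIn.1 hy).1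
    exact hc y hyA hyS t (mem_nbrIn.1 ht.1).1 t' (mem_nbrIn.1 ht'.1).1 ht.2 ht'.2

theorem IsClosedIn.degSum_union_outerBoundary (hc : G.IsClosedIn A S) :
    G.degSum (S ∪ G.outerBoundary A S) =
      G.degSum S + G.degSum (G.outerBoundary A S) + 2 * (G.outerBoundary A S).card := by
  rw [degSum_union disjoint_outerBoundary, Finset.sum_congr rfl (g := fun _ => 1)]
  · simp
  · intro x hx
    obtain ⟨hxA, hxS, s, hs, hxs⟩ := mem_outerBoundary.1 hx
    refine le_antisymm (Finset.card_le_one.2 fun a ha b hb => ?_)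
      (Finset.card_pos.2 ⟨s, mem_nbrIn.2 ⟨hs, hxs⟩⟩)
    rw [mem_nbrIn] at ha hb
    exact hc x hxA hxS a ha.1 b hb.1 ha.2 hb.2

theorem IsQuadConn.two_le_card_nbrIn_outerBoundary (hA : G.IsQuadConn A) (hSA : S ⊆ A)
    (hc : G.IsClosedIn A S) (hdeg : ∀ s ∈ S, 2 ≤ (G.nbrIn S s).card) {x : V}
    (hx : x ∈ G.outerBoundary A S) : 2 ≤ (G.nbrIn (G.outerBoundary A S) x).card := by
  obtain ⟨-, -, s, hs, hxs⟩ := mem_outerBoundary.1 hx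
  exact (hdeg s hs).trans (hA.card_nbrIn_le_lift hSA hc hx hs hxs)

theorem two_le_card_nbrIn_insert {x : V} (hdeg : ∀ s ∈ S, 2 ≤ (G.nbrIn S s).card)
    (hx : 2 ≤ (G.nbrIn S x).card) : ∀ s ∈ insert x S, 2 ≤ (G.nbrIn (insert x S) s).card := by
  intro s hs
  refine le_trans ?_ (card_nbrIn_mono (Finset.subset_insert x S) s)
  rcases Finset.mem_insert.1 hs with rfl | hs
  exacts [hx, hdeg s hs]

theorem IsQuadConn.two_le_card_nbrIn_union (hA : G.IsQuadConn A) (hSA : S ⊆ A)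
    (hc : G.IsClosedIn A S) (hdeg : ∀ s ∈ S, 2 ≤ (G.nbrIn S s).card) :
    ∀ s ∈ S ∪ G.outerBoundary A S, 2 ≤ (G.nbrIn (S ∪ G.outerBoundary A S) s).card := by
  intro s hs
  rcases Finset.mem_union.1 hs with hs | hs
  · exact (hdeg s hs).trans (card_nbrIn_mono Finset.subset_union_left s)
  · exact (hA.two_le_card_nbrIn_outerBoundary hSA hc hdeg hs).trans
      (card_nbrIn_mono Finset.subset_union_right s)

theorem outerBoundary_subset : G.outerBoundary A S ⊆ A := fun _ hx => (mem_outerBoundary.1 hx).1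

/-- The quantity `degSum - 4 * card` does not decrease from `S` to `A`. -/
theorem IsQuadConn.degSum_growth (hA : G.IsQuadConn A) (hSA : S ⊆ A) (hS : S.Nonempty)
    (hdeg : ∀ s ∈ S, 2 ≤ (G.nbrIn S s).card) :
    G.degSum S + 4 * A.card ≤ G.degSum A + 4 * S.card := by
  induction hk : (A \ S).card using Nat.strong_induction_on generalizing S with
  | _ k ih =>
  subst hk
  by_cases hne : S = A
  · rw [hne]
  have key : ∀ T, S ⊂ T → T ⊆ A → (∀ s ∈ T, 2 ≤ (G.nbrIn T s).card) →
      G.degSum S + 4 * T.card ≤ G.degSum T + 4 * S.card →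
      G.degSum S + 4 * A.card ≤ G.degSum A + 4 * S.card := by
    intro T hST hTA hT hle
    have := ih (A \ T).card (Finset.card_lt_card (Finset.ssubset_iff_subset_ne.2
      ⟨Finset.sdiff_subset_sdiff le_rfl hST.1, fun h => ?_⟩)) hTA (hS.mono hST.1) hT rfl
    · omega
    · obtain ⟨y, hyT, hyS⟩ := Finset.exists_of_ssubset hST
      have : y ∈ A \ T := h ▸ Finset.mem_sdiff.2 ⟨hTA hyT, hyS⟩
      exact (Finset.mem_sdiff.1 this).2 hyT
  by_cases hc : ∀ x ∈ A, x ∉ S → (G.nbrIn S x).card < 2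
  · have hc := isClosedIn_of_card hc
    obtain ⟨x, hx⟩ := hA.outerBoundary_nonempty hSA hS hne
    -- Each boundary vertex brings one edge to `S`, counted twice, and by lifting has degree at
    -- least two inside the boundary: at least four per vertex in total.
    refine key (S ∪ G.outerBoundary A S)
      (Finset.ssubset_iff_of_subset Finset.subset_union_left |>.2
        ⟨x, Finset.mem_union_right _ hx, (mem_outerBoundary.1 hx).2.1⟩)
      (Finset.union_subset hSA outerBoundary_subset)
      (hA.two_le_card_nbrIn_union hSA hc hdeg) ?_
    rw [hc.degSum_union_outerBoundary, Finset.card_union_of_disjoint disjoint_outerBoundary]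
    have := two_mul_card_le_degSum (S := G.outerBoundary A S) (G := G)
      fun s hs => hA.two_le_card_nbrIn_outerBoundary hSA hc hdeg hs
    omega
  · push Not at hc
    obtain ⟨x, hxA, hxS, hx⟩ := hc
    refine key (insert x S) (Finset.ssubset_insert hxS) (Finset.insert_subset hxA hSA)
      (two_le_card_nbrIn_insert hdeg hx) ?_
    rw [degSum_insert hxS, Finset.card_insert_of_notMem hxS]
    omega

/-- In an extremal graph, three vertices with the same neighbours have at most two neighbours. -/
theorem IsQuadConn.card_nbrIn_le_two_of_twins (hA : G.IsQuadConn A)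
    (hD : G.degSum A + 8 = 4 * A.card) {a b c : V} (ha : a ∈ A) (hb : b ∈ A) (hc : c ∈ A)
    (hab : a ≠ b) (hac : a ≠ c) (hbc : b ≠ c) (h1 : G.nbrIn A a = G.nbrIn A b)
    (h2 : G.nbrIn A a = G.nbrIn A c) : (G.nbrIn A a).card ≤ 2 := by
  by_contra! h3
  set D := G.nbrIn A a with hDdef
  have hDA : D ⊆ A := fun y hy => (mem_nbrIn.1 hy).1
  have ea : ∀ y ∈ D, G.Adj a y := fun y hy => (mem_nbrIn.1 hy).2
  have eb : ∀ y ∈ D, G.Adj b y := fun y hy => (mem_nbrIn.1 (h1 ▸ hy)).2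
  have ec : ∀ y ∈ D, G.Adj c y := fun y hy => (mem_nbrIn.1 (h2 ▸ hy)).2
  have hdisj : Disjoint D {a, b, c} := by
    rw [Finset.disjoint_left]
    intro y hy hy'
    simp only [Finset.mem_insert, Finset.mem_singleton] at hy'
    rcases hy' with rfl | rfl | rfl
    exacts [G.irrefl (ea _ hy), G.irrefl (eb _ hy), G.irrefl (ec _ hy)]
  have hfull : ∀ x, (∀ y ∈ D, G.Adj x y) → G.nbrIn D x = D := fun x hx => by
    ext y
    simpa using fun hy => hx y hy
  have hcard : ({a, b, c} : Finset V).card = 3 := Finset.card_eq_three.2 ⟨a, b, c, hab, hac, hbc, rfl⟩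
  have hsub : D ∪ {a, b, c} ⊆ A := Finset.union_subset hDA (by
    intro y hy
    simp only [Finset.mem_insert, Finset.mem_singleton] at hy
    rcases hy with rfl | rfl | rfl <;> assumption)
  have hT : ∀ x ∈ ({a, b, c} : Finset V), G.nbrIn D x = D := by
    intro x hx
    simp only [Finset.mem_insert, Finset.mem_singleton] at hx
    rcases hx with rfl | rfl | rfl
    exacts [hfull _ ea, hfull _ eb, hfull _ ec]
  have hg := hA.degSum_growth hsub ⟨a, by simp⟩ (by
    intro s hs
    rcases Finset.mem_union.1 hs with hs | hs
    · refine le_trans (Finset.one_lt_card.2 ⟨a, ?_, b, ?_, hab⟩)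
        (card_nbrIn_mono Finset.subset_union_right s)
      · simp [(ea s hs).symm]
      · simp [(eb s hs).symm]
    · refine le_trans ?_ (card_nbrIn_mono Finset.subset_union_left s)
      rw [hT s hs]
      omega)
  -- With `d = D.card`, the edges between `D` and the three twins contribute `6 * d`, while growth
  -- to the extremal `A` allows at most `4 * (d + 3) - 8`. Hence `d ≤ 2`.
  rw [degSum_union hdisj, Finset.card_union_of_disjoint hdisj, hcard,
    Finset.sum_congr rfl (g := fun _ => D.card) (fun x hx => by rw [hT x hx])] at hg
  simp only [Finset.sum_const, hcard, smul_eq_mul] at hg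
  omega

/-- An edge leaving `{x, a}` either starts at `x`, or joins `a` to some `z`; then `x` and `z` share
`a`, hence a second neighbour. -/
theorem IsQuadConn.two_le_card_nbrIn (hA : G.IsQuadConn A) (h3 : 3 ≤ A.card) {x : V}
    (hx : x ∈ A) : 2 ≤ (G.nbrIn A x).card := by
  obtain ⟨a, ha⟩ := hA.nbrIn_nonempty (by omega) hx
  obtain ⟨haA, hxa⟩ := mem_nbrIn.1 ha
  obtain ⟨y, hy, z, hz, hzB, hyz⟩ := hA.exists_adj {x, a}
    (by intro y; simp only [Finset.mem_insert, Finset.mem_singleton]; rintro (rfl | rfl) <;> assumption)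
    (by simp) (by rintro rfl; have := Finset.card_le_two (a := x) (b := a); omega)
  simp only [Finset.mem_insert, Finset.mem_singleton, not_or] at hy hzB
  rcases hy with rfl | rfl
  · exact Finset.one_lt_card.2 ⟨a, ha, z, mem_nbrIn.2 ⟨hz, hyz⟩, Ne.symm hzB.2⟩
  · obtain ⟨s, hs, hsy, hxs, -⟩ := hA.exists_other x hx z hz y haA (Ne.symm hzB.1) hxa hyz.symm
    exact Finset.one_lt_card.2 ⟨y, ha, s, mem_nbrIn.2 ⟨hs, hxs⟩, hsy.symm⟩

/-- There is a set of four vertices containing a four-cycle. -/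
theorem IsQuadConn.exists_fourCycle (hA : G.IsQuadConn A) (h3 : 3 ≤ A.card) :
    ∃ S ⊆ A, S.card = 4 ∧ ∀ s ∈ S, 2 ≤ (G.nbrIn S s).card := by
  obtain ⟨a, ha⟩ : A.Nonempty := Finset.card_pos.1 (by omega)
  obtain ⟨x, hx, y, hy, hxy⟩ := Finset.one_lt_card.1 (hA.two_le_card_nbrIn h3 ha)
  rw [mem_nbrIn] at hx hy
  obtain ⟨b, hb, hba, hxb, hyb⟩ := hA.exists_other x hx.1 y hy.1 a ha hxy hx.2.symm hy.2.symm
  refine ⟨{a, b, x, y}, ?_, ?_, ?_⟩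
  · intro z
    simp only [Finset.mem_insert, Finset.mem_singleton]
    rintro (rfl | rfl | rfl | rfl)
    exacts [ha, hb, hx.1, hy.1]
  · rw [Finset.card_insert_of_notMem, Finset.card_insert_of_notMem, Finset.card_pair hxy]
    · simp [hxb.ne', hyb.ne']
    · simp [hba.symm, hx.2.ne, hy.2.ne]
  · intro z
    simp only [Finset.mem_insert, Finset.mem_singleton]
    rintro (rfl | rfl | rfl | rfl)
    · exact Finset.one_lt_card.2 ⟨x, by simp [hx.2], y, by simp [hy.2], hxy⟩
    · exact Finset.one_lt_card.2 ⟨x, by simp [hxb.symm], y, by simp [hyb.symm], hxy⟩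
    · exact Finset.one_lt_card.2 ⟨a, by simp [hx.2.symm], b, by simp [hxb], hba.symm⟩
    · exact Finset.one_lt_card.2 ⟨a, by simp [hy.2.symm], b, by simp [hyb], hba.symm⟩

/-- The lower bound of Reid and Thomassen on the number of edges of a connected quadrangular
graph. -/
theorem IsQuadConn.four_mul_card_le (hA : G.IsQuadConn A) (h3 : 3 ≤ A.card) :
    4 * A.card ≤ G.degSum A + 8 := by
  obtain ⟨S, hSA, hS, hdeg⟩ := hA.exists_fourCycle h3
  have := hA.degSum_growth hSA (Finset.card_pos.1 (by omega)) hdeg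
  have := two_mul_card_le_degSum hdeg
  omega

/-! ### Extremal graphs of minimum degree three -/

/-- An extremal graph without vertices of degree two has the order of the cube. -/
theorem IsQuadConn.card_eq_eight (hA : G.IsQuadConn A) (hD : G.degSum A + 8 = 4 * A.card)
    (h3 : ∀ x ∈ A, 3 ≤ (G.nbrIn A x).card) : A.card = 8 := by
  have hA3 : 3 ≤ A.card := by
    have h0 : A.Nonempty := Finset.card_pos.1 (by omega)
    obtain ⟨x, hx⟩ := h0
    exact (h3 x hx).trans (Finset.card_le_card fun y hy => (mem_nbrIn.1 hy).1)
  have hDA : 3 * A.card ≤ G.degSum A := by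
    rw [mul_comm]
    exact Finset.card_nsmul_le_sum _ _ _ h3
  obtain ⟨S₀, hS₀A, hS₀, hdeg₀⟩ := hA.exists_fourCycle hA3
  have hS₀D := two_mul_card_le_degSum hdeg₀
  -- The growth argument is run backwards from `A`: a largest proper subset `S` from which `A` is
  -- reached in one growth step.
  let F : Finset (Finset V) := open Classical in A.powerset.filter fun S =>
    S ≠ A ∧ S.Nonempty ∧ (∀ s ∈ S, 2 ≤ (G.nbrIn S s).card) ∧ 4 * S.card ≤ G.degSum S + 8
  have hF : ∀ S, S ∈ F ↔ S ⊆ A ∧ S ≠ A ∧ S.Nonempty ∧ (∀ s ∈ S, 2 ≤ (G.nbrIn S s).card) ∧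
      4 * S.card ≤ G.degSum S + 8 := fun S => by simp [F]
  obtain ⟨S, hSF, hmax⟩ := Finset.exists_max_image F Finset.card
    ⟨S₀, (hF S₀).2 ⟨hS₀A, by rintro rfl; omega, Finset.card_pos.1 (by omega), hdeg₀, by omega⟩⟩
  obtain ⟨hSA, hne, hS, hdeg, hSD⟩ := (hF S).1 hSF
  have hstep : ∀ T ⊆ A, S ⊂ T → (∀ s ∈ T, 2 ≤ (G.nbrIn T s).card) →
      4 * T.card ≤ G.degSum T + 8 → T = A := by
    intro T hTA hST hT hTD
    by_contra hTne
    have := hmax T ((hF T).2 ⟨hTA, hTne, hS.mono hST.1, hT, hTD⟩)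
    have := Finset.card_lt_card hST
    omega
  have hc : G.IsClosedIn A S := by
    -- A one-vertex step would end at `A`, so the added vertex would have all its neighbours, at
    -- least three, in `S`; the degree sum would rise by at least six and overshoot equality.
    refine isClosedIn_of_card fun x hxA hxS => ?_
    by_contra! hx
    have hins := degSum_insert (G := G) hxS
    have hcard := Finset.card_insert_of_notMem hxS
    have hTA := hstep (insert x S) (Finset.insert_subset hxA hSA) (Finset.ssubset_insert hxS)
      (two_le_card_nbrIn_insert hdeg hx) (by omega)
    have hxdeg : (G.nbrIn A x).card = (G.nbrIn S x).card := by
      rw [← hTA]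
      congr 1
      ext y
      simp only [mem_nbrIn, Finset.mem_insert]
      refine ⟨fun ⟨h, hxy⟩ => ⟨h.resolve_left ?_, hxy⟩, fun ⟨h, hxy⟩ => ⟨Or.inr h, hxy⟩⟩
      rintro rfl
      exact G.irrefl hxy
    have := h3 x hxA
    rw [hTA] at hins hcard
    omega
  set H := G.outerBoundary A S with hH
  have hHne : H.Nonempty := hA.outerBoundary_nonempty hSA hS hne
  have hU := hc.degSum_union_outerBoundary
  have hUc := Finset.card_union_of_disjoint (disjoint_outerBoundary (G := G) (A := A) (S := S))
  rw [← hH] at hU hUc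
  have hHdeg : ∀ x ∈ H, 2 ≤ (G.nbrIn H x).card := fun x hx =>
    hA.two_le_card_nbrIn_outerBoundary hSA hc hdeg hx
  have hHD := two_mul_card_le_degSum hHdeg
  have hSHA : S ∪ H = A := by
    refine hstep _ (Finset.union_subset hSA outerBoundary_subset) ?_
      (hA.two_le_card_nbrIn_union hSA hc hdeg) (by omega)
    obtain ⟨x, hx⟩ := hHne
    exact Finset.ssubset_iff_of_subset Finset.subset_union_left |>.2
      ⟨x, Finset.mem_union_right _ hx, (mem_outerBoundary.1 hx).2.1⟩
  rw [hSHA] at hU hUc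
  -- Equality for `A` forces equality in both estimates, for `H` and for `S`.
  have hHD' : G.degSum H = 2 * H.card := by omega
  have hSD' : G.degSum S + 8 = 4 * S.card := by omega
  have hH2 : ∀ x ∈ H, (G.nbrIn H x).card = 2 := by
    have := (Finset.sum_eq_sum_iff_of_le hHdeg).1 (by
      rw [Finset.sum_const, smul_eq_mul, mul_comm]; exact hHD'.symm)
    exact fun x hx => (this x hx).symm
  have hmemA : ∀ y ∈ A, y ∈ S ∨ y ∈ H := fun y hy => Finset.mem_union.1 (hSHA ▸ hy)
  -- every vertex of `S` has a neighbour in `H`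
  have hcover : ∀ s ∈ S, ∃ x ∈ H, G.Adj x s := by
    by_contra! hcon
    obtain ⟨s₀, hs₀, hs₀H⟩ := hcon
    -- The vertices of `S` with a neighbour in `H` are closed under adjacency in `S`, by lifting; so
    -- an edge leaving `B` cannot exist.
    let B : Finset V := open Classical in H ∪ S.filter fun s => ∃ x ∈ H, G.Adj x s
    have hB : ∀ y, y ∈ B ↔ y ∈ H ∨ y ∈ S ∧ ∃ x ∈ H, G.Adj x y := fun y => by simp [B]
    have hs₀B : s₀ ∉ B := by
      rw [hB]
      rintro (h | ⟨-, x, hx, hxs⟩)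
      · exact (mem_outerBoundary.1 h).2.1 hs₀
      · exact hs₀H x hx hxs
    obtain ⟨y, hy, z, hz, hzB, hyz⟩ := hA.exists_adj B
      (by
        intro y hy
        rcases (hB y).1 hy with hy | hy
        exacts [outerBoundary_subset hy, hSA hy.1])
      (hHne.mono fun y hy => (hB y).2 (Or.inl hy))
      (by rintro h; exact hs₀B (h ▸ hSA hs₀))
    have hzS : z ∈ S := (hmemA z hz).resolve_right fun h => hzB ((hB z).2 (Or.inl h))
    rcases (hB y).1 hy with hy | ⟨hyS, x, hx, hxy⟩
    · exact hzB ((hB z).2 (Or.inr ⟨hzS, y, hy, hyz⟩))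
    · obtain ⟨w, hw, -, hwz⟩ := hA.exists_lift hSA hc hx hyS hxy hzS hyz
      exact hzB ((hB z).2 (Or.inr ⟨hzS, w, hw, hwz⟩))
  have hS2 : ∀ s ∈ S, (G.nbrIn S s).card = 2 := by
    intro s hs
    obtain ⟨x, hx, hxs⟩ := hcover s hs
    have := hA.card_nbrIn_le_lift hSA hc hx hs hxs
    rw [← hH, hH2 x hx] at this
    exact le_antisymm this (hdeg s hs)
  have hSD2 : G.degSum S = S.card * 2 := Finset.sum_const_nat hS2
  have hS4 : S.card = 4 := by omega
  -- `H` has at most as many vertices as `S`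
  have hHS : H.card ≤ S.card := by
    refine Finset.card_le_card_of_forall_subsingleton (fun x s => G.Adj x s) ?_ ?_
    · intro x hx
      exact (mem_outerBoundary.1 hx).2.2
    · rintro s hs x ⟨hx, hxs⟩ x' ⟨hx', hxs'⟩
      by_contra hxx
      obtain ⟨hxA, hxS, -⟩ := mem_outerBoundary.1 hx
      obtain ⟨hxA', hxS', -⟩ := mem_outerBoundary.1 hx'
      obtain ⟨y, hy, hys, hxy, hxy'⟩ := hA.exists_other x hxA x' hxA' s (hSA hs) hxx hxs hxs'
      have hyH : y ∈ H := (hmemA y hy).resolve_left fun h =>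
        hys (hc x hxA hxS y h s hs hxy hxs)
      obtain ⟨t, ht, hyt⟩ := (mem_outerBoundary.1 hyH).2.2
      -- `s` is a neighbour of `t`
      have hts : G.Adj t s := by
        by_contra hts
        -- If `t` is not adjacent to `s`, then `y` and the lifts of the two edges of `S` at `s` are
        -- three different neighbours of `x` in `H`, which is 2-regular.
        have hle := Finset.card_le_card_of_forall_subsingleton (s := insert y (G.nbrIn S s))
          (t := G.nbrIn H x) (fun t z => t = z ∨ t ∈ S ∧ G.Adj z t ∧ G.Adj s t) ?_ ?_
        · rw [Finset.card_insert_of_notMem (fun h => (mem_outerBoundary.1 hyH).2.1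
            (mem_nbrIn.1 h).1), hS2 s hs, hH2 x hx] at hle
          omega
        · intro r hr
          rcases Finset.mem_insert.1 hr with rfl | hr
          · exact ⟨r, mem_nbrIn.2 ⟨hyH, hxy⟩, Or.inl rfl⟩
          · obtain ⟨hrS, hsr⟩ := mem_nbrIn.1 hr
            obtain ⟨w, hw, hxw, hwr⟩ := hA.exists_lift hSA hc hx hs hxs hrS hsr
            exact ⟨w, mem_nbrIn.2 ⟨hw, hxw⟩, Or.inr ⟨hrS, hwr, hsr⟩⟩
        · have aux : ∀ r ∈ S, G.Adj y r → G.Adj s r → False := fun r hr hyr hsr => by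
            have : r = t := hc y hy (mem_outerBoundary.1 hyH).2.1 r hr t ht hyr hyt
            exact hts (this ▸ hsr.symm)
          intro z hz r hr r' hr'
          obtain ⟨hzA, hzS, -⟩ := mem_outerBoundary.1 (mem_nbrIn.1 hz).1
          obtain ⟨hr, hrz⟩ := hr
          obtain ⟨hr', hrz'⟩ := hr'
          rcases hrz with rfl | ⟨hrS, hzr, hsr⟩ <;> rcases hrz' with rfl | ⟨hrS', hzr', hsr'⟩
          · rfl
          · rcases Finset.mem_insert.1 hr with rfl | h
            · exact (aux _ hrS' hzr' hsr').elim
            · exact (hzS (mem_nbrIn.1 h).1).elim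
          · rcases Finset.mem_insert.1 hr' with rfl | h
            · exact (aux _ hrS hzr hsr).elim
            · exact (hzS (mem_nbrIn.1 h).1).elim
          · exact hc z hzA hzS r hrS r' hrS' hzr hzr'
      -- a second neighbour of `t` lifts to a third neighbour of `y`
      obtain ⟨r, hr, hrs⟩ := Finset.exists_mem_ne (s := G.nbrIn S t) (by
        have := hdeg t ht; omega) s
      obtain ⟨hrS, htr⟩ := mem_nbrIn.1 hr
      obtain ⟨w, hw, hyw, hwr⟩ := hA.exists_lift hSA hc hyH ht hyt hrS htr
      have hwx : ∀ z, z ∈ A → z ∉ S → G.Adj z s → w ≠ z := by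
        rintro z hzA hzS hzs rfl
        exact hrs (hc w hzA hzS r hrS s hs hwr hzs)
      have hle : ({x, x', w} : Finset V).card ≤ (G.nbrIn H y).card := by
        refine Finset.card_le_card fun z hz => ?_
        simp only [Finset.mem_insert, Finset.mem_singleton] at hz
        rcases hz with rfl | rfl | rfl
        exacts [mem_nbrIn.2 ⟨hx, hxy.symm⟩, mem_nbrIn.2 ⟨hx', hxy'.symm⟩, mem_nbrIn.2 ⟨hw, hyw⟩]
      rw [hH2 y hyH, Finset.card_eq_three.2 ⟨x, x', w, hxx, (hwx x hxA hxS hxs).symm,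
        (hwx x' hxA' hxS' hxs').symm, rfl⟩] at hle
      omega
  -- The degree bound gives `8 ≤ A.card`, and `S` and `H` have at most four vertices each.
  omega

theorem IsQuadConn.card_nbrIn_eq_three (hA : G.IsQuadConn A)
    (hD : G.degSum A + 8 = 4 * A.card) (h3 : ∀ x ∈ A, 3 ≤ (G.nbrIn A x).card) :
    ∀ x ∈ A, (G.nbrIn A x).card = 3 := by
  have h8 := hA.card_eq_eight hD h3
  have := (Finset.sum_eq_sum_iff_of_le h3).1 (by
    rw [Finset.sum_const, smul_eq_mul]; unfold degSum at hD; omega)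
  exact fun x hx => (this x hx).symm

/-! ### Deleting a vertex of degree two -/

/-- If `w ≠ q` is adjacent to one of `a`, `b`, it shares that neighbour with `q`, so it must share
the other. -/
theorem IsQuadConn.adj_iff_adj_of_nbrIn_eq_pair (hA : G.IsQuadConn A) {q a b : V} (hq : q ∈ A)
    (hab : G.nbrIn A q = {a, b}) {w : V} (hw : w ∈ A) : G.Adj a w ↔ G.Adj b w := by
  have ha : a ∈ G.nbrIn A q := by simp [hab]
  have hb : b ∈ G.nbrIn A q := by simp [hab]
  rw [mem_nbrIn] at ha hb
  by_cases hqw : q = w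
  · subst hqw
    exact iff_of_true ha.2.symm hb.2.symm
  have aux : ∀ a' ∈ A, G.Adj q a' → G.Adj a' w → ∃ s ∈ ({a, b} : Finset V), s ≠ a' ∧ G.Adj s w := by
    intro a' ha' hqa' haw
    obtain ⟨s, hs, hsa, hqs, hws⟩ := hA.exists_other q hq w hw a' ha' hqw hqa' haw.symm
    exact ⟨s, hab ▸ mem_nbrIn.2 ⟨hs, hqs⟩, hsa, hws.symm⟩
  constructor <;> intro h
  · obtain ⟨s, hs, hsa, hsw⟩ := aux a ha.1 ha.2 h
    simp only [Finset.mem_insert, Finset.mem_singleton] at hs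
    exact hs.resolve_left hsa ▸ hsw
  · obtain ⟨s, hs, hsa, hsw⟩ := aux b hb.1 hb.2 h
    simp only [Finset.mem_insert, Finset.mem_singleton] at hs
    exact hs.resolve_right hsa ▸ hsw

/-- Whatever `q` provided, as a link or as a common neighbour, concerns only `a` and `b`. These are
twins with a further common neighbour, which takes over the role of `q`. -/
theorem IsQuadConn.erase (hA : G.IsQuadConn A) {q a b : V} (hq : q ∈ A)
    (hab : G.nbrIn A q = {a, b}) (ha3 : 3 ≤ (G.nbrIn A a).card) : G.IsQuadConn (A.erase q) := by
  have htw : ∀ w ∈ A, G.Adj a w ↔ G.Adj b w := fun w hw => hA.adj_iff_adj_of_nbrIn_eq_pair hq hab hw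
  have hthird : ∀ s, ∃ z ∈ A, z ≠ q ∧ z ≠ s ∧ G.Adj a z := by
    intro s
    obtain ⟨z, hz, hzn⟩ := Finset.exists_mem_notMem_of_card_lt_card
      (lt_of_le_of_lt (Finset.card_le_two (a := q) (b := s)) ha3)
    simp only [Finset.mem_insert, Finset.mem_singleton, not_or] at hzn
    exact ⟨z, (mem_nbrIn.1 hz).1, hzn.1, hzn.2, (mem_nbrIn.1 hz).2⟩
  have hqn : ∀ y ∈ A, G.Adj q y → y = a ∨ y = b := fun y hy hqy => by
    simpa [hab] using mem_nbrIn.2 ⟨hy, hqy⟩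
  constructor
  · intro B hBA hB hBne
    have hqB : q ∉ B := fun h => (Finset.mem_erase.1 (hBA h)).1 rfl
    have hBA' : B ⊆ A := hBA.trans (Finset.erase_subset _ _)
    by_cases hAB : a ∈ B ∧ b ∈ B
    · obtain ⟨x, hx, y, hy, hyB, hxy⟩ := hA.exists_adj (insert q B) (Finset.insert_subset hq hBA')
        (by simp) (by rintro rfl; exact hBne (Finset.erase_insert hqB).symm)
      rw [Finset.mem_insert, not_or] at hyB
      rcases Finset.mem_insert.1 hx with rfl | hx
      · rcases hqn y hy hxy with rfl | rfl
        exacts [(hyB.2 hAB.1).elim, (hyB.2 hAB.2).elim]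
      · exact ⟨x, hx, y, Finset.mem_erase.2 ⟨hyB.1, hy⟩, hyB.2, hxy⟩
    · obtain ⟨x, hx, y, hy, hyB, hxy⟩ := hA.exists_adj B hBA' hB (by rintro rfl; exact hqB hq)
      by_cases hyq : y = q
      · subst hyq
        obtain ⟨z, hz, hzq, -, haz⟩ := hthird y
        have hxc := hqn x (hBA' hx) hxy.symm
        have haA : a ∈ A ∧ b ∈ A := by
          have h1 : a ∈ G.nbrIn A y := by simp [hab]
          have h2 : b ∈ G.nbrIn A y := by simp [hab]
          exact ⟨(mem_nbrIn.1 h1).1, (mem_nbrIn.1 h2).1⟩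
        have hxz : G.Adj x z := by
          rcases hxc with rfl | rfl
          exacts [haz, (htw z hz).1 haz]
        by_cases hzB : z ∈ B
        · obtain ⟨c, hcA, hcB, hcq, hzc⟩ : ∃ c ∈ A, c ∉ B ∧ G.Adj y c ∧ G.Adj z c := by
            have h1 : a ∈ G.nbrIn A y := by simp [hab]
            have h2 : b ∈ G.nbrIn A y := by simp [hab]
            by_cases haB : a ∈ B
            · exact ⟨b, haA.2, fun h => hAB ⟨haB, h⟩, (mem_nbrIn.1 h2).2, ((htw z hz).1 haz).symm⟩
            · exact ⟨a, haA.1, haB, (mem_nbrIn.1 h1).2, haz.symm⟩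
          exact ⟨z, hzB, c, Finset.mem_erase.2 ⟨hcq.ne', hcA⟩, hcB, hzc⟩
        · exact ⟨x, hx, z, Finset.mem_erase.2 ⟨hzq, hz⟩, hzB, hxz⟩
      · exact ⟨x, hx, y, Finset.mem_erase.2 ⟨hyq, hy⟩, hyB, hxy⟩
  · intro x hx y hy s hs hxy hxs hys
    have hxA := Finset.mem_of_mem_erase hx
    have hyA := Finset.mem_of_mem_erase hy
    obtain ⟨s', hs', hss, hxs', hys'⟩ := hA.exists_other x hxA y hyA s
      (Finset.mem_of_mem_erase hs) hxy hxs hys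
    by_cases hsq : s' = q
    · subst hsq
      obtain ⟨z, hz, hzq, hzs, haz⟩ := hthird s
      have : ∀ x ∈ A, G.Adj x s' → G.Adj x z := by
        intro x hx hxs
        rcases hqn x hx hxs.symm with rfl | rfl
        exacts [haz, (htw z hz).1 haz]
      exact ⟨z, Finset.mem_erase.2 ⟨hzq, hz⟩, hzs, this x hxA hxs', this y hyA hys'⟩
    · exact ⟨s', Finset.mem_erase.2 ⟨hsq, hs'⟩, hss, hxs', hys'⟩

theorem nbrIn_erase (q x : V) : G.nbrIn (A.erase q) x = (G.nbrIn A x).erase q := by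
  ext y
  simp [and_assoc]

theorem degSum_erase {q : V} (hq : q ∈ A) :
    G.degSum (A.erase q) + 2 * (G.nbrIn A q).card = G.degSum A := by
  have h := degSum_insert (G := G) (Finset.notMem_erase q A)
  rw [Finset.insert_erase hq] at h
  rw [h, nbrIn_erase, Finset.erase_eq_of_notMem (s := G.nbrIn A q) (by simp)]

/-- Edges leave `B` only through `u` and `v`, so membership in `B` is a separating predicate. -/
theorem isSeparated_of_nbrIn_subset {u v i i' : V} {B : Finset V}
    (hB : ∀ x ∈ B, G.nbrIn A x ⊆ B ∪ {u, v}) (hi : i ∈ B) (hi' : i' ∉ B) :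
    G.IsSeparated A u v i i' := by
  refine ⟨(· ∈ B), hi, hi', ?_⟩
  have aux : ∀ x ∈ A, ∀ y ∈ A, x ≠ u → x ≠ v → y ≠ u → y ≠ v → G.Adj x y → x ∈ B → y ∈ B := by
    intro x _ y hy _ _ hyu hyv hxy hx
    have := hB x hx (mem_nbrIn.2 ⟨hy, hxy⟩)
    simpa [hyu, hyv] using this
  exact fun x hx y hy a b c d e => ⟨aux x hx y hy a b c d e, aux y hy x hx c d a b e.symm⟩

/-! ### Twins in extremal graphs -/

/-- The graph is cubic. Each of the three common neighbours of `u` and `v` has one further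
neighbour, which quadrangularity makes it share with another of the three. Hence all three have the
same one, a third twin of degree three, which is impossible. -/
theorem IsQuadConn.not_twins_of_three_le (hA : G.IsQuadConn A)
    (hD : G.degSum A + 8 = 4 * A.card) (h3 : ∀ x ∈ A, 3 ≤ (G.nbrIn A x).card) {u v : V}
    (hu : u ∈ A) (hv : v ∈ A) (huv : u ≠ v) : G.nbrIn A u ≠ G.nbrIn A v := by
  intro htw
  have hd := hA.card_nbrIn_eq_three hD h3
  have hNv : ∀ i ∈ G.nbrIn A u, i ∈ A ∧ G.Adj u i ∧ G.Adj v i := fun i hi =>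
    ⟨(mem_nbrIn.1 hi).1, (mem_nbrIn.1 hi).2, (mem_nbrIn.1 (htw ▸ hi)).2⟩
  -- the third neighbour of a neighbour of `u`
  have hthird : ∀ i ∈ G.nbrIn A u, ∃ w ∈ A, w ≠ u ∧ w ≠ v ∧ G.nbrIn A i = {u, v, w} := by
    intro i hi
    obtain ⟨hiA, hui, hvi⟩ := hNv i hi
    obtain ⟨w, hw, hwn⟩ := Finset.exists_mem_notMem_of_card_lt_card
      (lt_of_le_of_lt (Finset.card_le_two (a := u) (b := v)) (h3 i hiA))
    simp only [Finset.mem_insert, Finset.mem_singleton, not_or] at hwn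
    refine ⟨w, (mem_nbrIn.1 hw).1, hwn.1, hwn.2, (Finset.eq_of_subset_of_card_le ?_ ?_).symm⟩
    · intro z hz
      simp only [Finset.mem_insert, Finset.mem_singleton] at hz
      rcases hz with rfl | rfl | rfl
      exacts [mem_nbrIn.2 ⟨hu, hui.symm⟩, mem_nbrIn.2 ⟨hv, hvi.symm⟩, hw]
    · rw [hd i hiA, Finset.card_eq_three.2 ⟨u, v, w, huv, Ne.symm hwn.1, Ne.symm hwn.2, rfl⟩]
  have hshare : ∀ i ∈ G.nbrIn A u, ∀ w ∈ A, w ≠ u → G.Adj i w →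
      ∃ j ∈ G.nbrIn A u, j ≠ i ∧ G.Adj j w := by
    intro i hi w hw hwu hiw
    obtain ⟨j, hj, hji, huj, hwj⟩ := hA.exists_other u hu w hw i (hNv i hi).1 hwu.symm
      (hNv i hi).2.1 hiw.symm
    exact ⟨j, mem_nbrIn.2 ⟨hj, huj⟩, hji, hwj.symm⟩
  have huniq : ∀ i ∈ G.nbrIn A u, ∀ w w', w ≠ u → w ≠ v → w' ≠ u → w' ≠ v → w ∈ A → w' ∈ A →
      G.Adj i w → G.Adj i w' → w = w' := by
    intro i hi w w' h1 h2 h3 h4 hwA hwA' hw hw'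
    obtain ⟨t, -, -, -, ht⟩ := hthird i hi
    have e1 : w ∈ G.nbrIn A i := mem_nbrIn.2 ⟨hwA, hw⟩
    have e2 : w' ∈ G.nbrIn A i := mem_nbrIn.2 ⟨hwA', hw'⟩
    simp only [ht, Finset.mem_insert, Finset.mem_singleton, h1, h2, h3, h4, false_or] at e1 e2
    rw [e1, e2]
  obtain ⟨i, j, k, hij, hik, hjk, hN⟩ := Finset.card_eq_three.1 (hd u hu)
  have hi : i ∈ G.nbrIn A u := by simp [hN]
  have hk : k ∈ G.nbrIn A u := by simp [hN]
  obtain ⟨w, hwA, hwu, hwv, hNi⟩ := hthird i hi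
  have hadj : ∀ l ∈ G.nbrIn A u, ∀ w, G.nbrIn A l = {u, v, w} → G.Adj l w := fun l hl w h =>
    (mem_nbrIn.1 (h ▸ (by simp) : w ∈ G.nbrIn A l)).2
  have hiw := hadj i hi w hNi
  obtain ⟨l, hl, hli, hlw⟩ := hshare i hi w hwA hwu hiw
  have hall : ∀ m ∈ G.nbrIn A u, G.Adj m w := by
    intro m hm
    obtain ⟨w', hwA', hwu', hwv', hNm⟩ := hthird m hm
    have hmw' := hadj m hm w' hNm
    obtain ⟨m', hm', hmm, hmw⟩ := hshare m hm w' hwA' hwu' hmw'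
    by_cases hmi : m = i
    · exact hmi ▸ hiw
    by_cases hml : m = l
    · exact hml ▸ hlw
    have : m' = i ∨ m' = l := by
      rw [hN] at hm hm' hl
      simp only [Finset.mem_insert, Finset.mem_singleton] at hm hm' hl
      grind
    have hw'' : w = w' := by
      rcases this with rfl | rfl
      · exact huniq m' hi w w' hwu hwv hwu' hwv' hwA hwA' hiw hmw
      · exact huniq m' hl w w' hwu hwv hwu' hwv' hwA hwA' hlw hmw
    exact hw'' ▸ hmw'
  have hNw : G.nbrIn A u = G.nbrIn A w := by
    refine Finset.eq_of_subset_of_card_le (fun m hm => mem_nbrIn.2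
      ⟨(hNv m hm).1, (hall m hm).symm⟩) ?_
    rw [hd u hu, hd w hwA]
  have := hA.card_nbrIn_le_two_of_twins hD hu hv hwA huv hwu.symm hwv.symm htw hNw
  have := h3 u hu
  omega

theorem nbrIn_eq_pair_of_card_le_two {u v i : V} (huv : u ≠ v) (hu : u ∈ G.nbrIn A i)
    (hv : v ∈ G.nbrIn A i) (h2 : (G.nbrIn A i).card ≤ 2) : G.nbrIn A i = {u, v} := by
  refine (Finset.eq_of_subset_of_card_le ?_ ?_).symm
  · intro z hz
    simp only [Finset.mem_insert, Finset.mem_singleton] at hz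
    rcases hz with rfl | rfl <;> assumption
  · rwa [Finset.card_pair huv]

theorem isSeparated_of_card_le_two {u v i i' : V} (huv : u ≠ v) (hii : i ≠ i')
    (hu : u ∈ G.nbrIn A i) (hv : v ∈ G.nbrIn A i) (h2 : (G.nbrIn A i).card ≤ 2) :
    G.IsSeparated A u v i i' := by
  refine isSeparated_of_nbrIn_subset (B := {i}) ?_ (by simp) (by simpa using hii.symm)
  intro x hx
  rw [Finset.mem_singleton] at hx
  rw [hx, nbrIn_eq_pair_of_card_le_two huv hu hv h2]
  exact Finset.subset_union_right

/-- A separation of `A \ {q, u, v}` extends to the vertex `q`, whose neighbours are the twins `a`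
and `b`. -/
theorem IsSeparated.of_erase {q a b u v i i' : V} (ha : a ∈ A) (hb : b ∈ A)
    (hab : G.nbrIn A q = {a, b}) (htw : ∀ w ∈ A, G.Adj a w ↔ G.Adj b w)
    (hqi : i ≠ q) (hqi' : i' ≠ q) (hc : ∃ c ∈ A, c ≠ q ∧ c ≠ u ∧ c ≠ v ∧ G.Adj a c)
    (h : G.IsSeparated (A.erase q) u v i i') : G.IsSeparated A u v i i' := by
  obtain ⟨P, hi, hi', hP⟩ := h
  obtain ⟨c, hcA, hcq, hcu, hcv, hac⟩ := hc
  have hbc := (htw c hcA).1 hac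
  have hqn : ∀ y ∈ A, G.Adj q y → y = a ∨ y = b := fun y hy hqy => by
    simpa [hab] using mem_nbrIn.2 ⟨hy, hqy⟩
  have haq : a ≠ q := by
    rintro rfl
    exact G.irrefl (mem_nbrIn.1 (hab ▸ (by simp) : a ∈ G.nbrIn A a)).2
  have hbq : b ≠ q := by
    rintro rfl
    exact G.irrefl (mem_nbrIn.1 (hab ▸ (by simp) : b ∈ G.nbrIn A b)).2
  have hP' : ∀ x ∈ A, x ≠ q → ∀ y ∈ A, y ≠ q → x ≠ u → x ≠ v → y ≠ u → y ≠ v → G.Adj x y →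
      (P x ↔ P y) := fun x hx hxq y hy hyq =>
    hP x (Finset.mem_erase.2 ⟨hxq, hx⟩) y (Finset.mem_erase.2 ⟨hyq, hy⟩)
  have hacP : ∀ y ∈ A, G.Adj q y → y ≠ u → y ≠ v → (P c ↔ P y) := by
    intro y hy hqy hyu hyv
    rcases hqn y hy hqy with rfl | rfl
    · exact hP' c hcA hcq y hy haq hcu hcv hyu hyv hac.symm
    · exact hP' c hcA hcq y hy hbq hcu hcv hyu hyv hbc.symm
  -- The side of `q` is that of `c`, a surviving common neighbour of `a` and `b` that forces both
  -- onto its side unless they are removed.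
  refine ⟨fun x => if x = q then P c else P x, by simpa [hqi] using hi, by simpa [hqi'] using hi',
    ?_⟩
  intro x hx y hy hxu hxv hyu hyv hxy
  by_cases hxq : x = q
  · subst hxq
    simpa [hxy.ne'] using hacP y hy hxy hyu hyv
  · by_cases hyq : y = q
    · subst hyq
      simpa [hxy.ne] using (hacP x hx hxy.symm hxu hxv).symm
    · simpa [hxq, hyq] using hP' x hx hxq y hy hyq hxu hxv hyu hyv hxy

theorem twins_of_erase_of_adj_iff {q i i' : V} (h : G.nbrIn (A.erase q) i = G.nbrIn (A.erase q) i')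
    (hq : G.Adj i q ↔ G.Adj i' q) : G.nbrIn A i = G.nbrIn A i' := by
  ext y
  by_cases hy : y = q
  · subst hy
    simp [hq]
  · have := Finset.ext_iff.1 h y
    simpa [hy] using this

/-- Two common neighbours of a pair of twins `u`, `v` in an extremal graph are twins themselves, or
else `u` and `v` separate them. -/
theorem IsQuadConn.twins_or_isSeparated (hA : G.IsQuadConn A)
    (hD : G.degSum A + 8 = 4 * A.card) {u v i i' : V} (hu : u ∈ A) (hv : v ∈ A) (huv : u ≠ v)
    (hii : i ≠ i') (htw : G.nbrIn A u = G.nbrIn A v) (hi : i ∈ G.nbrIn A u)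
    (hi' : i' ∈ G.nbrIn A u) :
    G.nbrIn A i = G.nbrIn A i' ∨ G.IsSeparated A u v i i' := by
  induction hk : A.card generalizing A with
  | zero => simp [Finset.card_eq_zero.1 hk] at hu
  | succ k ih =>
  have hiA := (mem_nbrIn.1 hi).1
  have hiA' := (mem_nbrIn.1 hi').1
  have hui : u ∈ G.nbrIn A i := mem_nbrIn.2 ⟨hu, (mem_nbrIn.1 hi).2.symm⟩
  have hvi : v ∈ G.nbrIn A i := mem_nbrIn.2 ⟨hv, (mem_nbrIn.1 (htw ▸ hi)).2.symm⟩
  have hui' : u ∈ G.nbrIn A i' := mem_nbrIn.2 ⟨hu, (mem_nbrIn.1 hi').2.symm⟩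
  have hvi' : v ∈ G.nbrIn A i' := mem_nbrIn.2 ⟨hv, (mem_nbrIn.1 (htw ▸ hi')).2.symm⟩
  by_cases hi2 : (G.nbrIn A i).card ≤ 2
  · exact Or.inr (isSeparated_of_card_le_two huv hii hui hvi hi2)
  by_cases hi2' : (G.nbrIn A i').card ≤ 2
  · exact Or.inr (isSeparated_of_card_le_two huv hii.symm hui' hvi' hi2').symm
  by_cases h3 : ∀ x ∈ A, 3 ≤ (G.nbrIn A x).card
  · exact (hA.not_twins_of_three_le hD h3 hu hv huv htw).elim
  push Not at h3
  obtain ⟨q, hq, hq3⟩ := h3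
  have hA3 : 3 ≤ A.card := (Nat.lt_of_not_le hi2).trans_le
    (Finset.card_le_card fun y hy => (mem_nbrIn.1 hy).1)
  have hq2 : (G.nbrIn A q).card = 2 := le_antisymm (by omega) (hA.two_le_card_nbrIn hA3 hq)
  obtain ⟨a, b, hab', hab⟩ := Finset.card_eq_two.1 hq2
  have hadj : ∀ w ∈ A, G.Adj a w ↔ G.Adj b w := fun w hw =>
    hA.adj_iff_adj_of_nbrIn_eq_pair hq hab hw
  have haq := mem_nbrIn.1 (hab ▸ (by simp) : a ∈ G.nbrIn A q)
  have hbq := mem_nbrIn.1 (hab ▸ (by simp) : b ∈ G.nbrIn A q)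
  have hNab : G.nbrIn A a = G.nbrIn A b := by
    ext w
    simp only [mem_nbrIn]
    exact and_congr_right fun hw => hadj w hw
  have hiq : i ≠ q := by rintro rfl; omega
  have hiq' : i' ≠ q := by rintro rfl; omega
  -- if `a` has no third neighbour then `A` is a four-cycle
  by_cases ha3 : (G.nbrIn A a).card ≤ 2
  · have hqa : q ∈ G.nbrIn A a := mem_nbrIn.2 ⟨hq, haq.2.symm⟩
    have ha2 := le_antisymm ha3 (hA.two_le_card_nbrIn hA3 haq.1)
    obtain ⟨w, hw, hwq⟩ := Finset.exists_mem_ne (s := G.nbrIn A a) (by omega) q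
    obtain ⟨hwA, haw⟩ := mem_nbrIn.1 hw
    have hNa : G.nbrIn A a = {q, w} := nbrIn_eq_pair_of_card_le_two hwq.symm hqa hw ha3
    have hNw : G.nbrIn A w ⊆ {a, b} := by
      intro z hz
      obtain ⟨hzA, hwz⟩ := mem_nbrIn.1 hz
      by_contra hzab
      simp only [Finset.mem_insert, Finset.mem_singleton, not_or] at hzab
      obtain ⟨s, hs, hsw, has, hzs⟩ := hA.exists_other a haq.1 z hzA w hwA (Ne.symm hzab.1) haw
        hwz.symm
      have hsq : s = q := by
        have : s ∈ G.nbrIn A a := mem_nbrIn.2 ⟨hs, has⟩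
        simpa [hNa, hsw] using this
      subst hsq
      have : z ∈ G.nbrIn A s := mem_nbrIn.2 ⟨hzA, hzs.symm⟩
      simp [hab, hzab.1, hzab.2] at this
    have hall : A = {a, b, q, w} := by
      by_contra hne
      obtain ⟨y, hy, z, hz, hzB, hyz⟩ := hA.exists_adj {a, b, q, w} (by
        intro y hy
        simp only [Finset.mem_insert, Finset.mem_singleton] at hy
        rcases hy with rfl | rfl | rfl | rfl
        exacts [haq.1, hbq.1, hq, hwA]) (by simp) (Ne.symm hne)
      have hzN : z ∈ G.nbrIn A y := mem_nbrIn.2 ⟨hz, hyz⟩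
      simp only [Finset.mem_insert, Finset.mem_singleton, not_or] at hy hzB
      rcases hy with rfl | rfl | rfl | rfl
      · simp [hNa, hzB] at hzN
      · simp [← hNab, hNa, hzB] at hzN
      · simp [hab, hzB] at hzN
      · have := hNw hzN
        simp [hzB] at this
    have hi4 : i = a ∨ i = b ∨ i = q ∨ i = w := by
      have := hiA
      rw [hall] at this
      simpa using this
    rcases hi4 with rfl | rfl | rfl | rfl
    · exact (hi2 ha3).elim
    · exact (hi2 (hNab ▸ ha3)).elim
    · exact (hiq rfl).elim
    · exact (hi2 ((Finset.card_le_card hNw).trans Finset.card_le_two)).elim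
  have hcard := Finset.card_erase_of_mem hq
  have hdel := degSum_erase (G := G) hq
  have hAe := hA.erase hq hab (by omega)
  have hDe : G.degSum (A.erase q) + 8 = 4 * (A.erase q).card := by omega
  by_cases hquv : q = u ∨ q = v
  · left
    -- Here `i` and `i'` are `a` and `b` themselves.
    have hN : G.nbrIn A u = {a, b} := by
      rcases hquv with rfl | rfl
      exacts [hab, htw.trans hab]
    rw [hN] at hi hi'
    simp only [Finset.mem_insert, Finset.mem_singleton] at hi hi'
    rcases hi with rfl | rfl <;> rcases hi' with rfl | rfl
    exacts [(hii rfl).elim, hNab, hNab.symm, (hii rfl).elim]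
  push Not at hquv
  have hi_iff : ∀ z ∈ A, z ≠ a → z ≠ b → ¬ G.Adj z q := fun z hz hza hzb hzq => by
    have : z ∈ G.nbrIn A q := mem_nbrIn.2 ⟨hz, hzq.symm⟩
    simp [hab, hza, hzb] at this
  -- the case where `a` and `b` have no neighbours besides `q`, `u` and `v`
  by_cases hc : ∃ c ∈ A, c ≠ q ∧ c ≠ u ∧ c ≠ v ∧ G.Adj a c
  swap
  · push Not at hc
    have hsub : ∀ x ∈ ({a, b, q} : Finset V), G.nbrIn A x ⊆ {a, b, q} ∪ {u, v} := by
      have h1 : G.nbrIn A a ⊆ {a, b, q} ∪ {u, v} := by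
        intro z hz
        obtain ⟨hzA, haz⟩ := mem_nbrIn.1 hz
        have := hc z hzA
        simp only [Finset.mem_union, Finset.mem_insert, Finset.mem_singleton]
        tauto
      intro x hx
      simp only [Finset.mem_insert, Finset.mem_singleton] at hx
      rcases hx with rfl | rfl | rfl
      · exact h1
      · exact hNab ▸ h1
      · rw [hab]
        intro z
        simp only [Finset.mem_union, Finset.mem_insert, Finset.mem_singleton]
        tauto
    by_cases hiB : i ∈ ({a, b, q} : Finset V) <;> by_cases hiB' : i' ∈ ({a, b, q} : Finset V)
    · left
      simp only [Finset.mem_insert, Finset.mem_singleton, hiq, hiq', or_false] at hiB hiB'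
      rcases hiB with rfl | rfl <;> rcases hiB' with rfl | rfl
      exacts [(hii rfl).elim, hNab, hNab.symm, (hii rfl).elim]
    · exact Or.inr (isSeparated_of_nbrIn_subset hsub hiB hiB')
    · exact Or.inr (isSeparated_of_nbrIn_subset hsub hiB' hiB).symm
    · simp only [Finset.mem_insert, Finset.mem_singleton, not_or] at hiB hiB'
      rcases ih hAe hDe (Finset.mem_erase.2 ⟨hquv.1.symm, hu⟩) (Finset.mem_erase.2 ⟨hquv.2.symm, hv⟩)
        (by rw [nbrIn_erase, nbrIn_erase, htw]) (by rw [nbrIn_erase]; simp [hiq, hiA, (mem_nbrIn.1 hi).2])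
        (by rw [nbrIn_erase]; simp [hiq', hiA', (mem_nbrIn.1 hi').2]) (by omega) with h | h
      · exact Or.inl (twins_of_erase_of_adj_iff h
          (iff_of_false (hi_iff i hiA hiB.1 hiB.2.1) (hi_iff i' hiA' hiB'.1 hiB'.2.1)))
      · obtain ⟨P, hPi, hPi', hP⟩ := h
        -- The block `{a, b, q}` is attached only through `u` and `v`, so it may be moved entirely
        -- to the side of `i'`.
        refine Or.inr ⟨fun x => P x ∧ x ∉ ({a, b, q} : Finset V), ⟨hPi, by simp [hiB]⟩,
          fun h => hPi' h.1, ?_⟩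
        have aux : ∀ x ∈ A, ∀ y ∈ A, x ≠ u → x ≠ v → y ≠ u → y ≠ v → G.Adj x y →
            P x ∧ x ∉ ({a, b, q} : Finset V) → P y ∧ y ∉ ({a, b, q} : Finset V) := by
          rintro x hx y hy hxu hxv hyu hyv hxy ⟨hPx, hxB⟩
          have hyB : y ∉ ({a, b, q} : Finset V) := fun hyB => by
            have := hsub y hyB (mem_nbrIn.2 ⟨hx, hxy.symm⟩)
            rcases Finset.mem_union.1 this with h | h
            · exact hxB h
            · simp [hxu, hxv] at h
          refine ⟨(hP x (Finset.mem_erase.2 ⟨?_, hx⟩) y (Finset.mem_erase.2 ⟨?_, hy⟩) hxu hxv hyu hyv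
            hxy).1 hPx, hyB⟩
          · rintro rfl; simp at hxB
          · rintro rfl; simp at hyB
        exact fun x hx y hy h1 h2 h3 h4 h5 => ⟨aux x hx y hy h1 h2 h3 h4 h5,
          aux y hy x hx h3 h4 h1 h2 h5.symm⟩
  rcases ih hAe hDe (Finset.mem_erase.2 ⟨hquv.1.symm, hu⟩) (Finset.mem_erase.2 ⟨hquv.2.symm, hv⟩)
    (by rw [nbrIn_erase, nbrIn_erase, htw]) (by rw [nbrIn_erase]; simp [hiq, hiA, (mem_nbrIn.1 hi).2])
    (by rw [nbrIn_erase]; simp [hiq', hiA', (mem_nbrIn.1 hi').2]) (by omega) with h | h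
  · by_cases hqq : G.Adj i q ↔ G.Adj i' q
    · exact Or.inl (twins_of_erase_of_adj_iff h hqq)
    -- Exactly one of `i`, `i'` is adjacent to `q`, so it is `a` or `b`; after the deletion the
    -- other becomes a third twin.
    exfalso
    have hNab' : G.nbrIn (A.erase q) a = G.nbrIn (A.erase q) b := by
      rw [nbrIn_erase, nbrIn_erase, hNab]
    have haE : a ∈ A.erase q := Finset.mem_erase.2 ⟨haq.2.ne', haq.1⟩
    have hbE : b ∈ A.erase q := Finset.mem_erase.2 ⟨hbq.2.ne', hbq.1⟩
    -- a third twin `z` of `a` and `b` outside the neighbourhood of `q` has degree two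
    have aux : ∀ y z, y ∈ A → z ∈ A → z ≠ q → 2 < (G.nbrIn A z).card → G.Adj y q → ¬ G.Adj z q →
        G.nbrIn (A.erase q) y = G.nbrIn (A.erase q) z → False := by
      intro y z hy hz hzq hz2 hyq hzq' hyz
      have hya : y = a ∨ y = b := by
        by_contra hne
        push Not at hne
        exact hi_iff y hy hne.1 hne.2 hyq
      have haz : G.nbrIn (A.erase q) a = G.nbrIn (A.erase q) z := by
        rcases hya with rfl | rfl
        exacts [hyz, hNab'.trans hyz]
      have hza : a ≠ z := by rintro rfl; exact hzq' haq.2.symm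
      have hzb : b ≠ z := by rintro rfl; exact hzq' hbq.2.symm
      have := hAe.card_nbrIn_le_two_of_twins hDe haE hbE (Finset.mem_erase.2 ⟨hzq, hz⟩) hab' hza
        hzb hNab' haz
      rw [haz, nbrIn_erase, Finset.erase_eq_of_notMem (by simp [hzq'])] at this
      omega
    by_cases h1 : G.Adj i q
    · exact aux i i' hiA hiA' hiq' (by omega) h1 (fun h2 => hqq (iff_of_true h1 h2)) h
    · by_cases h2 : G.Adj i' q
      · exact aux i' i hiA' hiA hiq (by omega) h2 h1 h.symm
      · exact hqq (iff_of_false h1 h2)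
  · exact Or.inr (h.of_erase haq.1 hbq.1 hab hadj hiq hiq' hc)

end SimpleGraph

/-! ### From matrices to bipartite graphs -/

-- A zero block with `R.card + C.card ≥ n` can be trimmed to a forbidden one; the two side
-- conditions exclude empty blocks with a full other side.
open Finset in
theorem IsIndecomposable.card_add_card_lt {n : ℕ} (hn : 2 ≤ n) {M : Matrix (Fin n) (Fin n) ℕ}
    (hM : IsIndecomposable M) {R C : Finset (Fin n)} (h0 : ∀ i ∈ R, ∀ j ∈ C, M i j = 0)
    (h1 : R = ∅ → C ≠ univ) (h2 : C = ∅ → R ≠ univ) : R.card + C.card < n := by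
  have hlt : ∀ S : Finset (Fin n), S ≠ univ → S.card < n := fun S hS => by
    simpa using Finset.card_lt_univ_of_notMem (not_forall.1 (mt eq_univ_iff_forall.2 hS)).choose_spec
  rcases R.eq_empty_or_nonempty with hR | hR
  · simpa [hR] using hlt C (h1 hR)
  rcases C.eq_empty_or_nonempty with hC | hC
  · simpa [hC] using hlt R (h2 hC)
  by_contra! h
  have hR' := hR.card_pos
  have hC' := hC.card_pos
  obtain ⟨R', hR'R, hR'c⟩ := exists_subset_card_eq (s := R) (n := min R.card (n - 1)) (by omega)
  obtain ⟨C', hC'C, hC'c⟩ := exists_subset_card_eq (s := C) (n := n - min R.card (n - 1)) (by omega)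
  exact hM ⟨min R.card (n - 1), R', C', by omega, by omega, hR'c, hC'c,
    fun i hi j hj => h0 i (hR'R hi) j (hC'C hj)⟩

/-- The bipartite graph of a square matrix: rows and columns, joined by the nonzero entries. -/
def bipartiteGraph {n : ℕ} (M : Matrix (Fin n) (Fin n) ℕ) : SimpleGraph (Fin n ⊕ Fin n) where
  Adj
    | .inl i, .inr j => M i j ≠ 0
    | .inr j, .inl i => M i j ≠ 0
    | _, _ => False
  symm := ⟨by rintro (i | i) (j | j) h <;> exact h⟩
  loopless := ⟨by rintro (i | i) h <;> exact h⟩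

section bipartiteGraph

variable {n : ℕ} {M : Matrix (Fin n) (Fin n) ℕ}

@[simp] theorem bipartiteGraph_adj_inl_inr {i j : Fin n} :
    (bipartiteGraph M).Adj (.inl i) (.inr j) ↔ M i j ≠ 0 := Iff.rfl

@[simp] theorem bipartiteGraph_adj_inr_inl {i j : Fin n} :
    (bipartiteGraph M).Adj (.inr j) (.inl i) ↔ M i j ≠ 0 := Iff.rfl

@[simp] theorem bipartiteGraph_adj_inl_inl {i j : Fin n} :
    ¬ (bipartiteGraph M).Adj (.inl i) (.inl j) := id

@[simp] theorem bipartiteGraph_adj_inr_inr {i j : Fin n} :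
    ¬ (bipartiteGraph M).Adj (.inr i) (.inr j) := id

theorem IsZeroOneMatrix.ite_eq (h : IsZeroOneMatrix M) (i j : Fin n) :
    (if M i j ≠ 0 then 1 else 0) = M i j := by
  rcases h i j with h | h <;> simp [h]

theorem IsZeroOneMatrix.eq_one (h : IsZeroOneMatrix M) {i j : Fin n} (hij : M i j ≠ 0) :
    M i j = 1 := (h i j).resolve_left hij

theorem IsZeroOneMatrix.card_nbrIn_inl (h : IsZeroOneMatrix M) (i : Fin n) :
    ((bipartiteGraph M).nbrIn Finset.univ (.inl i)).card = ∑ j, M i j := by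
  rw [SimpleGraph.nbrIn, Finset.card_filter, Fintype.sum_sum_type]
  simp only [bipartiteGraph_adj_inl_inl, if_false, Finset.sum_const_zero, zero_add]
  refine Finset.sum_congr rfl fun j _ => ?_
  rcases h i j with h | h <;> simp [h]

theorem IsZeroOneMatrix.card_nbrIn_inr (h : IsZeroOneMatrix M) (j : Fin n) :
    ((bipartiteGraph M).nbrIn Finset.univ (.inr j)).card = ∑ i, M i j := by
  rw [SimpleGraph.nbrIn, Finset.card_filter, Fintype.sum_sum_type]
  simp only [bipartiteGraph_adj_inr_inr, if_false, Finset.sum_const_zero, add_zero]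
  refine Finset.sum_congr rfl fun i _ => ?_
  rcases h i j with h | h <;> simp [h]

theorem IsZeroOneMatrix.degSum_eq (h : IsZeroOneMatrix M) :
    (bipartiteGraph M).degSum Finset.univ = 2 * ∑ i, ∑ j, M i j := by
  simp only [SimpleGraph.degSum, Fintype.sum_sum_type, h.card_nbrIn_inl, h.card_nbrIn_inr]
  rw [Finset.sum_comm (f := fun j i => M i j)]
  ring

theorem exists_ne_of_sum_mul_ne_one {f g : Fin n → ℕ} (hf : ∀ k, f k = 0 ∨ f k = 1)
    (hg : ∀ k, g k = 0 ∨ g k = 1) (h : ∑ k, f k * g k ≠ 1) {k : Fin n} (hfk : f k ≠ 0)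
    (hgk : g k ≠ 0) : ∃ l, l ≠ k ∧ f l ≠ 0 ∧ g l ≠ 0 := by
  by_contra! hcon
  refine h ?_
  rw [Finset.sum_eq_single k, (hf k).resolve_left hfk, (hg k).resolve_left hgk]
  · intro l _ hl
    by_cases hfl : f l = 0
    · simp [hfl]
    · simp [hcon l hl hfl]
  · simp

open Finset in
theorem isQuadConn_bipartiteGraph (hn : 2 ≤ n) (h01 : IsZeroOneMatrix M)
    (hi : IsIndecomposable M) (hq : IsQuadrangular M) :
    (bipartiteGraph M).IsQuadConn univ := by
  classical
  constructor
  · intro B _ hB hBne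
    by_contra! hcon
    have hzero : ∀ x ∈ B, ∀ y ∉ B, ¬ (bipartiteGraph M).Adj x y :=
      fun x hx y hy => hcon x hx y (mem_univ _) hy
    let R := univ.filter fun i => Sum.inl i ∈ B
    let C := univ.filter fun j => Sum.inr j ∈ B
    have hR : ∀ i, i ∈ R ↔ Sum.inl i ∈ B := by simp [R]
    have hC : ∀ i, i ∈ C ↔ Sum.inr i ∈ B := by simp [C]
    have hRc : ∀ i, i ∈ Rᶜ ↔ Sum.inl i ∉ B := by simp [R]
    have hCc : ∀ i, i ∈ Cᶜ ↔ Sum.inr i ∉ B := by simp [C]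
    have h1 : ∀ i ∈ R, ∀ j ∈ Cᶜ, M i j = 0 := fun i hi j hj => by
      simpa using hzero _ ((hR i).1 hi) _ ((hCc j).1 hj)
    have h2 : ∀ i ∈ Rᶜ, ∀ j ∈ C, M i j = 0 := fun i hi j hj => by
      simpa using hzero _ ((hC j).1 hj) _ ((hRc i).1 hi)
    have hcR := card_add_card_compl R
    have hcC := card_add_card_compl C
    rw [Fintype.card_fin] at hcR hcC
    have hne1 : R = ∅ → C ≠ ∅ := by
      intro hR0 hC0
      obtain ⟨x | x, hx⟩ := hB
      · simpa [hR0] using (hR x).2 hx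
      · simpa [hC0] using (hC x).2 hx
    have hne2 : R = univ → C ≠ univ := by
      intro hR0 hC0
      refine hBne (eq_univ_iff_forall.2 ?_)
      rintro (x | x)
      · exact (hR x).1 (by simp [hR0])
      · exact (hC x).1 (by simp [hC0])
    -- The zero blocks `R × Cᶜ` and `Rᶜ × C` have sizes adding up to `2 * n`, but each is less than
    -- `n`.
    have k1 := hi.card_add_card_lt hn h1 (by simpa using hne1)
      (by rw [compl_eq_empty_iff]; exact fun a b => hne2 b a)
    have k2 := hi.card_add_card_lt hn h2 (by rw [compl_eq_empty_iff]; exact hne2)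
      (by rw [Ne, compl_eq_univ_iff]; exact fun a b => hne1 b a)
    omega
  · rintro (i | i) - (i' | i') - (s | s) - hne h1 h2
    all_goals simp only [bipartiteGraph_adj_inl_inl, bipartiteGraph_adj_inr_inr,
      bipartiteGraph_adj_inl_inr, bipartiteGraph_adj_inr_inl] at h1 h2
    · obtain ⟨l, hl, h⟩ := exists_ne_of_sum_mul_ne_one (h01 i) (h01 i')
        (hq.1 i i' (by simpa using hne)) h1 h2
      exact ⟨.inr l, mem_univ _, by simpa using hl, h⟩
    · obtain ⟨l, hl, h⟩ := exists_ne_of_sum_mul_ne_one (fun k => h01 k i) (fun k => h01 k i')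
        (hq.2 i i' (by simpa using hne)) h1 h2
      exact ⟨.inl l, mem_univ _, by simpa using hl, h⟩

theorem IsZeroOneMatrix.numZeros_add_sum (h01 : IsZeroOneMatrix M) :
    numZeros M + ∑ i, ∑ j, M i j = n * n := by
  rw [numZeros, Finset.card_filter, Fintype.sum_prod_type, ← Finset.sum_add_distrib]
  have h1 : ∀ i j, (if M i j = 0 then 1 else 0) + M i j = 1 := fun i j => by
    rcases h01 i j with h | h <;> simp [h]
  simp only [← Finset.sum_add_distrib, h1]
  simp

theorem IsZeroOneMatrix.numZeros_eq_iff (hn : 2 ≤ n) (h01 : IsZeroOneMatrix M) :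
    numZeros M = (n - 2) ^ 2 ↔ ∑ i, ∑ j, M i j + 4 = 4 * n := by
  have h := h01.numZeros_add_sum
  obtain ⟨m, rfl⟩ := Nat.exists_eq_add_of_le hn
  rw [Nat.add_sub_cancel_left]
  constructor <;> intro h' <;> nlinarith

theorem four_mul_le_sum_add_four (hn : 2 ≤ n) (h01 : IsZeroOneMatrix M)
    (hi : IsIndecomposable M) (hq : IsQuadrangular M) : 4 * n ≤ ∑ i, ∑ j, M i j + 4 := by
  have := (isQuadConn_bipartiteGraph hn h01 hi hq).four_mul_card_le (by simp; omega)
  rw [h01.degSum_eq] at this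
  simp at this
  omega

theorem IsMaximalZeroPattern.transpose (hM : IsMaximalZeroPattern M) :
    IsMaximalZeroPattern M.transpose where
  isZeroOne i j := hM.isZeroOne j i
  indecomposable := by
    rintro ⟨s, R, C, h0, hs, hR, hC, h⟩
    exact hM.indecomposable ⟨n - s, C, R, by omega, by omega, hC, by omega,
      fun i hi j hj => h j hj i hi⟩
  quadrangular := ⟨hM.quadrangular.2, hM.quadrangular.1⟩
  numZeros_eq := by
    rw [← hM.numZeros_eq]
    exact Finset.card_equiv (Equiv.prodComm _ _) fun _ => by
      simp only [Finset.mem_filter, Finset.mem_univ, true_and]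
      exact Iff.rfl

end bipartiteGraph

/-! ### Explicit rational orthogonal matrices -/

/-- An orthogonal matrix of order four vanishing exactly on the diagonal. -/
def quaternionMatrix : Matrix (Fin 4) (Fin 4) ℚ :=
  !![0, 1/3, 2/3, 2/3; -1/3, 0, 2/3, -2/3; -2/3, -2/3, 0, 1/3; -2/3, 2/3, -1/3, 0]

theorem quaternionMatrix_mul_transpose : quaternionMatrix * quaternionMatrix.transpose = 1 := by
  ext i j
  fin_cases i <;> fin_cases j <;>
    simp [quaternionMatrix, Matrix.mul_apply, Fin.sum_univ_four] <;> norm_num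

theorem quaternionMatrix_eq_zero_iff {i j : Fin 4} : quaternionMatrix i j = 0 ↔ i = j := by
  fin_cases i <;> fin_cases j <;> norm_num [quaternionMatrix]

theorem exists_unique_zero_of_sum_eq_three {f : Fin 4 → ℕ} (hf : ∀ k, f k = 0 ∨ f k = 1)
    (h : ∑ k, f k = 3) : ∃ k, ∀ j, f j = 0 ↔ j = k := by
  rw [Fin.sum_univ_four] at h
  have h0 := hf 0
  have h1 := hf 1
  have h2 := hf 2
  have h3 := hf 3
  rcases h0 with h0 | h0
  · exact ⟨0, fun j => by fin_cases j <;> simp <;> omega⟩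
  rcases h1 with h1 | h1
  · exact ⟨1, fun j => by fin_cases j <;> simp <;> omega⟩
  rcases h2 with h2 | h2
  · exact ⟨2, fun j => by fin_cases j <;> simp <;> omega⟩
  · exact ⟨3, fun j => by fin_cases j <;> simp <;> omega⟩

/-- The zeros of `M` form a permutation matrix; permuting the rows of `quaternionMatrix` moves its
zero diagonal there. -/
theorem exists_orthogonal_of_sums_eq_three {M : Matrix (Fin 4) (Fin 4) ℕ}
    (h01 : IsZeroOneMatrix M) (hr : ∀ i, ∑ j, M i j = 3) (hc : ∀ j, ∑ i, M i j = 3) :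
    ∃ X : Matrix (Fin 4) (Fin 4) ℚ, X ∈ Matrix.orthogonalGroup (Fin 4) ℚ ∧ zeroPattern X = M := by
  choose σ hσ using fun i => exists_unique_zero_of_sum_eq_three (h01 i) (hr i)
  have hinj : Function.Injective σ := by
    intro i i' h
    obtain ⟨k, hk⟩ := exists_unique_zero_of_sum_eq_three (fun k => h01 k (σ i)) (hc (σ i))
    rw [(hk i).1 ((hσ i _).2 rfl), (hk i').1 ((hσ i' _).2 h)]
  let e := Equiv.ofBijective σ (Finite.injective_iff_bijective.1 hinj)
  refine ⟨quaternionMatrix.submatrix e id, ?_, ?_⟩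
  · rw [Matrix.mem_orthogonalGroup_iff, Matrix.transpose_submatrix,
      ← Matrix.submatrix_mul _ _ _ _ _ Function.bijective_id, quaternionMatrix_mul_transpose,
      Matrix.submatrix_one_equiv]
  · ext i j
    rw [← h01.ite_eq i j, zeroPattern]
    refine if_congr (not_congr ?_) rfl rfl
    rw [Matrix.submatrix_apply, quaternionMatrix_eq_zero_iff, hσ]
    exact eq_comm

/-- Bordering `X` by a row and a column of the identity, then rotating column `u` against the new
column. -/
def rotatedExtension {n : ℕ} (p v : Fin (n + 1)) (u : Fin n) (X : Matrix (Fin n) (Fin n) ℚ) :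
    Matrix (Fin (n + 1)) (Fin (n + 1)) ℚ :=
  p.insertNth (v.insertNth (3 / 5) fun j => if j = u then -4 / 5 else 0)
    fun i => v.insertNth (4 / 5 * X i u) fun j => X i j * if j = u then 3 / 5 else 1

section rotatedExtension

variable {n : ℕ} (p v : Fin (n + 1)) (u : Fin n) (X : Matrix (Fin n) (Fin n) ℚ)

theorem rotatedExtension_same_same : rotatedExtension p v u X p v = 3 / 5 := by
  simp [rotatedExtension]

theorem rotatedExtension_same_succAbove (j : Fin n) :
    rotatedExtension p v u X p (v.succAbove j) = if j = u then -4 / 5 else 0 := by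
  simp [rotatedExtension]

theorem rotatedExtension_succAbove_same (i : Fin n) :
    rotatedExtension p v u X (p.succAbove i) v = 4 / 5 * X i u := by
  simp [rotatedExtension]

theorem rotatedExtension_succAbove_succAbove (i j : Fin n) :
    rotatedExtension p v u X (p.succAbove i) (v.succAbove j) =
      X i j * if j = u then 3 / 5 else 1 := by
  simp [rotatedExtension]

variable {X}

theorem rotatedExtension_mem_orthogonalGroup (hX : X ∈ Matrix.orthogonalGroup (Fin n) ℚ) :
    rotatedExtension p v u X ∈ Matrix.orthogonalGroup (Fin (n + 1)) ℚ := by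
  rw [Matrix.mem_orthogonalGroup_iff] at hX ⊢
  have hrow : ∀ i i', ∑ j, X i j * X i' j = (1 : Matrix (Fin n) (Fin n) ℚ) i i' := fun i i' => by
    rw [← hX]
    simp [Matrix.mul_apply]
  ext r r'
  rw [Matrix.mul_apply, Fin.sum_univ_succAbove _ v]
  simp only [Matrix.transpose_apply]
  rcases Fin.eq_self_or_eq_succAbove p r with hr | ⟨i, rfl⟩ <;>
    rcases Fin.eq_self_or_eq_succAbove p r' with hr' | ⟨i', rfl⟩
  · subst hr hr'
    simp only [rotatedExtension_same_same, rotatedExtension_same_succAbove]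
    simp
    norm_num
  · subst hr
    simp only [rotatedExtension_same_same, rotatedExtension_same_succAbove,
      rotatedExtension_succAbove_same, rotatedExtension_succAbove_succAbove]
    rw [Matrix.one_apply_ne (Fin.succAbove_ne _ _).symm]
    simp only [ite_mul, zero_mul, Finset.sum_ite_eq', Finset.mem_univ, if_true]
    ring
  · subst hr'
    simp only [rotatedExtension_same_same, rotatedExtension_same_succAbove,
      rotatedExtension_succAbove_same, rotatedExtension_succAbove_succAbove]
    rw [Matrix.one_apply_ne (Fin.succAbove_ne _ _)]
    simp
    ring
  · simp only [rotatedExtension_succAbove_same, rotatedExtension_succAbove_succAbove]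
    -- Scaling column `u` by `3/5` loses `1 - 9/25 = 16/25` of its contribution, which the entries
    -- `4/5 * X i u` in column `v` restore.
    have hsum : ∑ j, X i j * (if j = u then 3 / 5 else 1) * (X i' j * if j = u then 3 / 5 else 1) =
        ∑ j, X i j * X i' j - 16 / 25 * (X i u * X i' u) := by
      rw [eq_sub_iff_add_eq, ← Finset.sum_erase_add _ _ (Finset.mem_univ u),
        ← Finset.sum_erase_add _ (fun j => X i j * X i' j) (Finset.mem_univ u),
        Finset.sum_congr rfl (g := fun j => X i j * X i' j)]
      · simp
        ring
      · intro j hj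
        simp [Finset.ne_of_mem_erase hj]
    rw [hsum, hrow, Matrix.one_apply, Matrix.one_apply]
    simp only [Fin.succAbove_right_inj]
    ring

theorem zeroPattern_rotatedExtension {M : Matrix (Fin (n + 1)) (Fin (n + 1)) ℕ}
    (h01 : IsZeroOneMatrix M) (hX : zeroPattern X = M.submatrix p.succAbove v.succAbove)
    (hp : ∀ j, M p j ≠ 0 ↔ j = v ∨ j = v.succAbove u)
    (htw : ∀ i, M i v = M i (v.succAbove u)) : zeroPattern (rotatedExtension p v u X) = M := by
  have hX' : ∀ i j, X i j ≠ 0 ↔ M (p.succAbove i) (v.succAbove j) ≠ 0 := fun i j => by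
    have := congrFun (congrFun hX i) j
    rw [Matrix.submatrix_apply] at this
    rw [← this, zeroPattern]
    simp
  ext r c
  rw [← h01.ite_eq r c, zeroPattern]
  refine if_congr ?_ rfl rfl
  rcases Fin.eq_self_or_eq_succAbove p r with rfl | ⟨i, rfl⟩ <;>
    rcases Fin.eq_self_or_eq_succAbove v c with rfl | ⟨j, rfl⟩
  · simp [rotatedExtension_same_same, hp]
  · rw [rotatedExtension_same_succAbove, hp]
    by_cases hj : j = u <;> simp [hj, Fin.succAbove_ne]
  · rw [rotatedExtension_succAbove_same, htw, ← hX']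
    simp
  · rw [rotatedExtension_succAbove_succAbove, ← hX']
    by_cases hj : j = u <;> simp [hj]

end rotatedExtension

/-! ### Reduction of maximal zero-patterns -/

section

variable {n : ℕ} {M : Matrix (Fin (n + 1)) (Fin (n + 1)) ℕ}

open Finset

theorem IsMaximalZeroPattern.sum_add_four {n : ℕ} {M : Matrix (Fin n) (Fin n) ℕ} (hn : 2 ≤ n)
    (hM : IsMaximalZeroPattern M) : ∑ i, ∑ j, M i j + 4 = 4 * n :=
  (hM.isZeroOne.numZeros_eq_iff hn).1 hM.numZeros_eq

theorem IsZeroOneMatrix.exists_pair_of_sum_eq_two (h01 : IsZeroOneMatrix M) {p : Fin (n + 1)}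
    (hp : ∑ j, M p j = 2) :
    ∃ (v : Fin (n + 1)) (u : Fin n), ∀ j, M p j ≠ 0 ↔ j = v ∨ j = v.succAbove u := by
  have h : (univ.filter fun j => M p j ≠ 0).card = 2 := by
    rw [card_filter, ← hp]
    exact sum_congr rfl fun j _ => h01.ite_eq p j
  obtain ⟨v, w, hvw, hs⟩ := card_eq_two.1 h
  obtain ⟨u, rfl⟩ := Fin.exists_succAbove_eq hvw.symm
  exact ⟨v, u, fun j => by simpa using Finset.ext_iff.1 hs j⟩

/-- The two columns meeting a row with exactly two nonzero entries are equal. -/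
theorem IsMaximalZeroPattern.column_eq (hM : IsMaximalZeroPattern M) {p v : Fin (n + 1)}
    {u : Fin n} (hp : ∀ j, M p j ≠ 0 ↔ j = v ∨ j = v.succAbove u) (i : Fin (n + 1)) :
    M i v = M i (v.succAbove u) := by
  have h01 := hM.isZeroOne
  by_cases hip : i = p
  · rw [hip, h01.eq_one ((hp v).2 (Or.inl rfl)), h01.eq_one ((hp _).2 (Or.inr rfl))]
  have key : ∀ a b, (∀ j, M p j ≠ 0 → j ≠ a → j = b) → M p a ≠ 0 → M i a ≠ 0 → M i b ≠ 0 := by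
    intro a b hab hpa hia
    obtain ⟨l, hl, hpl, hil⟩ := exists_ne_of_sum_mul_ne_one (h01 p) (h01 i)
      (hM.quadrangular.1 p i (Ne.symm hip)) hpa hia
    exact hab l hpl hl ▸ hil
  have h1 := key v (v.succAbove u) (fun j hj hjv => ((hp j).1 hj).resolve_left hjv)
    ((hp v).2 (Or.inl rfl))
  have h2 := key (v.succAbove u) v (fun j hj hjv => ((hp j).1 hj).resolve_right hjv)
    ((hp _).2 (Or.inr rfl))
  rcases h01 i v with h | h <;> rcases h01 i (v.succAbove u) with h' | h' <;> simp_all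

/-- Two rows meeting twin columns `v`, `w` of a maximal zero-pattern with a row supported on these
columns meet in a further column. -/
theorem IsMaximalZeroPattern.exists_third_common (hn : 2 ≤ n) (hM : IsMaximalZeroPattern M)
    {p v w : Fin (n + 1)} (hvw : v ≠ w) (hp : ∀ j, M p j ≠ 0 ↔ j = v ∨ j = w)
    (htw : ∀ i, M i v = M i w) {i i' : Fin (n + 1)} (hii : i ≠ i') (hip : i ≠ p) (hip' : i' ≠ p)
    (hi : M i v ≠ 0) (hi' : M i' v ≠ 0) : ∃ k, k ≠ v ∧ k ≠ w ∧ M i k ≠ 0 ∧ M i' k ≠ 0 := by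
  have h01 := hM.isZeroOne
  have hA := isQuadConn_bipartiteGraph (by omega) h01 hM.indecomposable hM.quadrangular
  have hD : (bipartiteGraph M).degSum univ + 8 = 4 * (univ : Finset (Fin (n + 1) ⊕ Fin (n + 1))).card := by
    have := hM.sum_add_four (by omega)
    rw [h01.degSum_eq]
    simp
    omega
  have hcard : ({v, w} : Finset (Fin (n + 1))).card = 2 := card_pair hvw
  have hcompl := card_add_card_compl ({v, w} : Finset (Fin (n + 1)))
  rw [hcard, Fintype.card_fin] at hcompl
  have h := hA.twins_or_isSeparated hD (u := .inr v) (v := .inr w) (i := .inl i) (i' := .inl i')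
    (mem_univ _) (mem_univ _) (by simpa using hvw) (by simpa using hii)
    (by
      ext y
      rcases y with y | y <;> simp [htw])
    (by simpa using hi) (by simpa using hi')
  rcases h with h | ⟨P, hPi, hPi', hP⟩
  · by_contra! hcon
    have hsame : ∀ k, M i k ≠ 0 ↔ M i' k ≠ 0 := fun k => by
      simpa using Finset.ext_iff.1 h (Sum.inr k)
    have hzero : ∀ k, k ≠ v → k ≠ w → M i k = 0 := fun k hkv hkw => by
      by_contra hik
      exact (hsame k).1 hik (hcon k hkv hkw hik)
    -- Both rows would vanish outside `v` and `w`: a zero block of size `2 + (n - 1)` in order `n +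
    -- 1`.
    have := hM.indecomposable.card_add_card_lt (by omega) (R := {i, i'}) (C := {v, w}ᶜ) (by
        intro r hr k hk
        simp only [mem_compl, mem_insert, mem_singleton, not_or] at hr hk
        rcases hr with rfl | rfl
        · exact hzero k hk.1 hk.2
        · exact not_not.1 (mt (hsame k).2 (not_not.2 (hzero k hk.1 hk.2)))) (by simp) (by
        intro h0
        rw [h0, card_empty] at hcompl
        omega)
    rw [card_pair hii] at this
    omega
  · exfalso
    classical
    have hP' : ∀ r k, k ≠ v → k ≠ w → M r k ≠ 0 → (P (.inl r) ↔ P (.inr k)) := fun r k h1 h2 h3 =>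
      hP (.inl r) (mem_univ _) (.inr k) (mem_univ _) (by simp) (by simp) (by simpa using h1)
        (by simpa using h2) h3
    have hpz : ∀ k, k ≠ v → k ≠ w → M p k = 0 := fun k hkv hkw => by
      by_contra h
      rcases (hp k).1 h with h | h
      exacts [hkv h, hkw h]
    -- The row `p` vanishes outside `v` and `w`, so it may be counted on both sides. The blocks `R₁
    -- × C₂` and `R₂ × C₁` then have total size `(n + 2) + (n - 1)`, more than the `2 * n` allowed.
    let R₁ : Finset (Fin (n + 1)) := univ.filter fun r => r = p ∨ P (.inl r)
    let R₂ : Finset (Fin (n + 1)) := univ.filter fun r => r = p ∨ ¬ P (.inl r)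
    let C₁ : Finset (Fin (n + 1)) := ({v, w}ᶜ : Finset _).filter fun k => P (.inr k)
    let C₂ : Finset (Fin (n + 1)) := ({v, w}ᶜ : Finset _).filter fun k => ¬ P (.inr k)
    have hR : R₁.card + R₂.card = n + 1 + 1 := by
      rw [← card_union_add_card_inter]
      have h1 : R₁ ∪ R₂ = univ := by
        ext r
        simp [R₁, R₂]
        tauto
      have h2 : R₁ ∩ R₂ = {p} := by
        ext r
        simp [R₁, R₂]
        tauto
      simp [h1, h2]
    have hC : C₁.card + C₂.card = ({v, w}ᶜ : Finset (Fin (n + 1))).card :=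
      card_filter_add_card_filter_not _
    have k1 := hM.indecomposable.card_add_card_lt (by omega) (R := R₁) (C := C₂) (by
        intro r hr k hk
        simp only [R₁, C₂, mem_filter, mem_univ, true_and, mem_compl, mem_insert, mem_singleton,
          not_or] at hr hk
        rcases hr with rfl | hr
        · exact hpz k hk.1.1 hk.1.2
        · by_contra h
          exact hk.2 ((hP' r k hk.1.1 hk.1.2 h).1 hr))
      (fun h0 => absurd (h0 ▸ (by simp [R₁]) : p ∈ (∅ : Finset _)) (by simp))
      (fun _ h0 => by
        have : i' ∈ R₁ := h0 ▸ mem_univ i'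
        simp [R₁, hip', hPi'] at this)
    have k2 := hM.indecomposable.card_add_card_lt (by omega) (R := R₂) (C := C₁) (by
        intro r hr k hk
        simp only [R₂, C₁, mem_filter, mem_univ, true_and, mem_compl, mem_insert, mem_singleton,
          not_or] at hr hk
        rcases hr with rfl | hr
        · exact hpz k hk.1.1 hk.1.2
        · by_contra h
          exact hr ((hP' r k hk.1.1 hk.1.2 h).2 hk.2))
      (fun h0 => absurd (h0 ▸ (by simp [R₂]) : p ∈ (∅ : Finset _)) (by simp))
      (fun _ h0 => by
        have : i ∈ R₂ := h0 ▸ mem_univ i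
        simp [R₂, hip, hPi] at this)
    omega

/-- Deleting a row with exactly two nonzero entries and one of the two columns it meets. -/
theorem IsMaximalZeroPattern.submatrix (hn : 2 ≤ n) (hM : IsMaximalZeroPattern M)
    {p v : Fin (n + 1)} {u : Fin n} (hp : ∀ j, M p j ≠ 0 ↔ j = v ∨ j = v.succAbove u) :
    IsMaximalZeroPattern (M.submatrix p.succAbove v.succAbove) := by
  have h01 := hM.isZeroOne
  have htw := hM.column_eq hp
  have hvu : v ≠ v.succAbove u := (Fin.succAbove_ne v u).symm
  have h01' : IsZeroOneMatrix (M.submatrix p.succAbove v.succAbove) := fun i j => h01 _ _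
  have hind : IsIndecomposable (M.submatrix p.succAbove v.succAbove) := by
    rintro ⟨s, R, C, hs0, hsn, hR, hC, h0⟩
    have h0' : ∀ i ∈ R.map p.succAboveEmb, ∀ j ∈ C.map v.succAboveEmb, M i j = 0 := by
      simpa using h0
    have hpR : p ∉ R.map p.succAboveEmb := by simp [Fin.succAbove_ne]
    have hvC : v ∉ C.map v.succAboveEmb := by simp [Fin.succAbove_ne]
    have hRne : R.map p.succAboveEmb ≠ ∅ := by
      rw [Ne, map_eq_empty]
      rintro rfl
      simp at hR
      omega
    have hCne : C.map v.succAboveEmb ≠ ∅ := by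
      rw [Ne, map_eq_empty]
      rintro rfl
      simp at hC
      omega
    -- The zero block extends to `M` by one line: the twin column `v` if `u ∈ C`, and otherwise the
    -- row `p`, which vanishes on `C`.
    by_cases hu : u ∈ C
    · have := hM.indecomposable.card_add_card_lt (by omega) (R := R.map p.succAboveEmb)
        (C := insert v (C.map v.succAboveEmb)) (by
          intro i hi j hj
          rcases mem_insert.1 hj with rfl | hj
          · rw [htw]
            exact h0' i hi _ (by simpa using hu)
          · exact h0' i hi j hj) (fun h => (hRne h).elim) (by simp)
      rw [card_insert_of_notMem hvC, card_map, card_map] at this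
      omega
    · have := hM.indecomposable.card_add_card_lt (by omega) (R := insert p (R.map p.succAboveEmb))
        (C := C.map v.succAboveEmb) (by
          intro i hi j hj
          rcases mem_insert.1 hi with rfl | hi
          · by_contra hij
            rcases (hp j).1 hij with rfl | rfl
            · exact hvC hj
            · exact hu (by simpa using hj)
          · exact h0' i hi j hj) (by simp) (fun h => (hCne h).elim)
      rw [card_insert_of_notMem hpR, card_map, card_map] at this
      omega
  have hquad : IsQuadrangular (M.submatrix p.succAbove v.succAbove) := by
    constructor
    · intro i i' hii
      have hq := hM.quadrangular.1 (p.succAbove i) (p.succAbove i') (by simpa using hii)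
      rw [Fin.sum_univ_succAbove _ v] at hq
      simp only [Matrix.submatrix_apply]
      by_cases h : M (p.succAbove i) v * M (p.succAbove i') v = 0
      · rwa [h, zero_add] at hq
      · obtain ⟨h1, h2⟩ := mul_ne_zero_iff.1 h
        obtain ⟨k, hkv, hku, hk1, hk2⟩ := hM.exists_third_common hn hvu hp htw
          (i := p.succAbove i) (i' := p.succAbove i') (by simpa using hii) (Fin.succAbove_ne _ _)
          (Fin.succAbove_ne _ _) h1 h2
        obtain ⟨l, rfl⟩ := Fin.exists_succAbove_eq hkv
        have hlu : l ≠ u := fun h => hku (h ▸ rfl)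
        rw [htw] at h1 h2
        -- The third column and the surviving twin already contribute two to the inner product.
        have hle := sum_le_sum_of_subset (subset_univ {l, u})
          (f := fun j => M (p.succAbove i) (v.succAbove j) * M (p.succAbove i') (v.succAbove j))
        rw [sum_pair hlu, h01.eq_one hk1, h01.eq_one hk2, h01.eq_one h1, h01.eq_one h2] at hle
        omega
    · intro j j' hjj
      have hq := hM.quadrangular.2 (v.succAbove j) (v.succAbove j') (by simpa using hjj)
      rw [Fin.sum_univ_succAbove _ p] at hq
      have h : M p (v.succAbove j) * M p (v.succAbove j') = 0 := by
        by_contra h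
        obtain ⟨h1, h2⟩ := mul_ne_zero_iff.1 h
        rw [hp] at h1 h2
        simp only [Fin.succAbove_ne, false_or, Fin.succAbove_right_inj] at h1 h2
        exact hjj (h1.trans h2.symm)
      rwa [h, zero_add] at hq
  refine ⟨h01', hind, hquad, (h01'.numZeros_eq_iff hn).2 ?_⟩
  -- This is one half of the required equality. For the other, at least four ones are deleted: two
  -- in row `p` and at least two more in column `v`.
  have hle := four_mul_le_sum_add_four hn h01' hind hquad
  have hsum := hM.sum_add_four (by omega)
  rw [Fin.sum_univ_succAbove _ p, sum_congr rfl (s₁ := (univ : Finset (Fin n)))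
    (fun i _ => Fin.sum_univ_succAbove _ v), sum_add_distrib] at hsum
  have hprow : ∑ j, M p j = 2 := by
    rw [← card_pair hvu, ← sum_congr rfl (fun j _ => h01.ite_eq p j), ← card_filter]
    congr 1
    ext j
    simp [← hp]
  have hcol := Fin.sum_univ_succAbove (fun i => M i v) p
  rw [h01.eq_one ((hp v).2 (Or.inl rfl))] at hcol
  -- Otherwise the zeros of column `v`, shared by its twin, form too large a zero block.
  have hcol3 : 3 ≤ ∑ i, M i v := by
    by_contra! hlt
    have hcard : (univ.filter fun i => M i v ≠ 0).card = ∑ i, M i v := by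
      rw [card_filter]
      exact sum_congr rfl fun j _ => h01.ite_eq _ _
    have hsplit := card_filter_add_card_filter_not (s := (univ : Finset (Fin (n + 1))))
      (fun i => M i v = 0)
    have := hM.indecomposable.card_add_card_lt (by omega) (R := univ.filter fun i => M i v = 0)
      (C := {v, v.succAbove u}) (by
        intro i hi j hj
        simp only [mem_filter, mem_univ, true_and, mem_insert, mem_singleton] at hi hj
        rcases hj with rfl | rfl
        exacts [hi, htw i ▸ hi]) (by
        intro _ h
        have := card_pair hvu
        rw [h, card_univ, Fintype.card_fin] at this
        omega) (by simp)
    rw [card_pair hvu] at this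
    rw [card_univ, Fintype.card_fin] at hsplit
    simp only [ne_eq] at hcard
    omega
  simp only [Matrix.submatrix_apply] at hle ⊢
  omega

theorem IsMaximalZeroPattern.exists_orthogonal_of_row_sum_eq_two (hn : 2 ≤ n)
    (ih : ∀ M : Matrix (Fin n) (Fin n) ℕ, IsMaximalZeroPattern M →
      ∃ X : Matrix (Fin n) (Fin n) ℚ, X ∈ Matrix.orthogonalGroup (Fin n) ℚ ∧ zeroPattern X = M)
    (hM : IsMaximalZeroPattern M) {p : Fin (n + 1)} (hp : ∑ j, M p j = 2) :
    ∃ X : Matrix (Fin (n + 1)) (Fin (n + 1)) ℚ,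
      X ∈ Matrix.orthogonalGroup (Fin (n + 1)) ℚ ∧ zeroPattern X = M := by
  obtain ⟨v, u, hvu⟩ := hM.isZeroOne.exists_pair_of_sum_eq_two hp
  obtain ⟨X, hX, hXM⟩ := ih _ (hM.submatrix hn hvu)
  exact ⟨_, rotatedExtension_mem_orthogonalGroup p v u hX,
    zeroPattern_rotatedExtension p v u hM.isZeroOne hXM hvu (hM.column_eq hvu)⟩

theorem exists_orthogonal_of_order_two {M : Matrix (Fin 2) (Fin 2) ℕ}
    (hM : IsMaximalZeroPattern M) :
    ∃ X : Matrix (Fin 2) (Fin 2) ℚ, X ∈ Matrix.orthogonalGroup (Fin 2) ℚ ∧ zeroPattern X = M := by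
  have hne : ∀ i j, M i j ≠ 0 := fun i j hij => by
    have h := hM.numZeros_eq
    rw [numZeros, Nat.sub_self, zero_pow two_ne_zero, card_eq_zero] at h
    have : (i, j) ∈ (∅ : Finset (Fin 2 × Fin 2)) := h ▸ by simpa using hij
    simp at this
  refine ⟨!![3/5, 4/5; -4/5, 3/5], ?_, ?_⟩
  · rw [Matrix.mem_orthogonalGroup_iff]
    ext i j
    fin_cases i <;> fin_cases j <;> simp [Matrix.mul_apply] <;> norm_num
  · ext i j
    rw [hM.isZeroOne.eq_one (hne i j)]
    fin_cases i <;> fin_cases j <;> simp [zeroPattern]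

end

/-! ### The induction on the order -/

theorem mainTheorem5 (n : ℕ) (hn : 2 ≤ n) (M : Matrix (Fin n) (Fin n) ℕ)
    (hM : IsMaximalZeroPattern M) :
    ∃ X : Matrix (Fin n) (Fin n) ℚ, X ∈ Matrix.orthogonalGroup (Fin n) ℚ ∧ zeroPattern X = M := by
  induction n, hn using Nat.le_induction with
  | base => exact exists_orthogonal_of_order_two hM
  | succ n hn ih =>
  have h01 := hM.isZeroOne
  have hA := isQuadConn_bipartiteGraph (by omega) h01 hM.indecomposable hM.quadrangular
  have hcard : (Finset.univ : Finset (Fin (n + 1) ⊕ Fin (n + 1))).card = 2 * (n + 1) := by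
    simp
    omega
  have hD : (bipartiteGraph M).degSum Finset.univ + 8 =
      4 * (Finset.univ : Finset (Fin (n + 1) ⊕ Fin (n + 1))).card := by
    have := hM.sum_add_four (by omega)
    rw [h01.degSum_eq]
    omega
  by_cases h3 : ∀ x ∈ Finset.univ, 3 ≤ ((bipartiteGraph M).nbrIn Finset.univ x).card
  · have h8 := hA.card_eq_eight hD h3
    obtain rfl : n = 3 := by omega
    have hd := hA.card_nbrIn_eq_three hD h3
    exact exists_orthogonal_of_sums_eq_three h01
      (fun i => h01.card_nbrIn_inl i ▸ hd (.inl i) (Finset.mem_univ _))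
      (fun j => h01.card_nbrIn_inr j ▸ hd (.inr j) (Finset.mem_univ _))
  · push Not at h3
    obtain ⟨x, hx, hx3⟩ := h3
    have hx2 := hA.two_le_card_nbrIn (by omega) hx
    rcases x with p | p
    · rw [h01.card_nbrIn_inl] at hx2 hx3
      exact hM.exists_orthogonal_of_row_sum_eq_two hn ih (p := p) (by omega)
    · rw [h01.card_nbrIn_inr] at hx2 hx3
      obtain ⟨X, hX, hXM⟩ := hM.transpose.exists_orthogonal_of_row_sum_eq_two hn ih (p := p) (by
        simp only [Matrix.transpose_apply]
        omega)
      refine ⟨X.transpose, ?_, ?_⟩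
      · rw [Matrix.mem_orthogonalGroup_iff, Matrix.transpose_transpose]
        exact (Matrix.mem_orthogonalGroup_iff' _ _).1 hX
      · rw [← M.transpose_transpose, ← hXM]
        rfl
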